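/- Let $U=[0,1]^2\subset\mathbb{R}^2$ be the unit square, and let $U_3=[-\tfrac12,\tfrac32]^2$ be the square of side length $2$ concentric and homothetic to $U$. A rectifiable curve is a curve of finite length, where the length $|\gamma|$ of a curve $\gamma$ is the supremum of the lengths of its inscribed polygonal lines. A barrier (opaque set) for $U$ is a union $\Gamma=\bigcup_{i}\gamma_i$ of a finite or countably infinite family of rectifiable curves with $\sum_i|\gamma_i|<\infty$ such that $\Gamma$ meets every line that meets $U$; its length is $\sum_i|\gamma_i|$. Then every barrier $\Gamma$ for $U$ with $\Gamma\subseteq U_3$ has length at least $2+10^{-12}$. -/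

import Mathlib

open scoped ENNReal

namespace OpaqueSquare

/-- The Euclidean plane. -/
abbrev Plane : Type := EuclideanSpace ℝ (Fin 2)

/-- A (compact, parametrized) curve in the plane. -/
abbrev Curve : Type := C(unitInterval, Plane)

/-- The length of a curve: the supremum of the lengths of its inscribed polygonal lines. -/
noncomputable def Curve.length (c : Curve) : ℝ≥0∞ :=
  eVariationOn (fun t : unitInterval => c t) Set.univ

/-- A rectifiable curve is a curve of finite length. -/
def Curve.IsRectifiable (c : Curve) : Prop :=
  Curve.length c < ∞

/-- The set of points covered by a family of curves. -/
def trace {ι : Type*} (γ : ι → Curve) : Set Plane :=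
  ⋃ i, Set.range (γ i)

/-- The total length of a family of curves. -/
noncomputable def totalLength {ι : Type*} (γ : ι → Curve) : ℝ≥0∞ :=
  ∑' i, Curve.length (γ i)

/-- A line in the plane: a one-dimensional affine subspace. -/
def IsLine (l : AffineSubspace ℝ Plane) : Prop :=
  Module.finrank ℝ l.direction = 1

/-- `Γ` is a barrier (opaque set) for `C`: it meets all lines that intersect `C`. -/
def IsBarrier (Γ C : Set Plane) : Prop :=
  ∀ l : AffineSubspace ℝ Plane, IsLine l →
    ((l : Set Plane) ∩ C).Nonempty → ((l : Set Plane) ∩ Γ).Nonempty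

/-- A countable family of rectifiable curves, of finite total length, whose union is a
barrier for `C`. (A finite family is a special case of a countable one.) -/
structure IsRectifiableBarrier {ι : Type*} (γ : ι → Curve) (C : Set Plane) : Prop where
  countable : Countable ι
  rectifiable : ∀ i, Curve.IsRectifiable (γ i)
  totalLength_lt_top : totalLength γ < ∞
  isBarrier : IsBarrier (trace γ) C

/-- The closed axis-parallel square `[a, b] × [a, b]`. -/
def square (a b : ℝ) : Set Plane :=
  {p | ∀ i, p i ∈ Set.Icc a b}

/-- The unit square `U = [0, 1]²`. -/
def unitSquare : Set Plane := square 0 1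

/-- The square of side length `2` concentric and homothetic to `U`: `[-1/2, 3/2]²`. -/
def doubleSquare : Set Plane := square (-1 / 2) (3 / 2)

end OpaqueSquare

/-!
Suppose that a barrier of length `L < 2 + ε`, `ε = 10⁻¹²`, lies in the double square. Put the
origin at the centre of the square. For a direction, let the *waste* be the amount by which the
projections of the pieces of the barrier, lengths added up, exceed the width of the square. It is
nonnegative, since the projections cover that of the square (`ParamBarrier.restrict_le_push`), and
by Cauchy's formula its integral over all directions is at most `2L - 4`
(`ParamBarrier.integral_waste_le`). So almost every line that meets the square meets the barrier
only once.

The two diagonal directions force almost all of the barrier to be nearly horizontal or nearly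
vertical, with about length `1` of either kind (`ParamBarrier.real_slanted_le`). Integrating `1`,
`r` and `r²` against the projections to the axes and the diagonals gives the first and second
moments up to small errors: `∫ y²` over the horizontal part and `∫ x²` over the vertical part add
up to about `1/2`, so one of them is at least about `1/4`, while the means are near `0`. By symmetry
take the horizontal part. As `|y| ≤ 1`, a definite length `A` of it lies above the height `1/16`
and a definite length `B` below the height `-1/16`
(`ParamBarrier.lt_real_horiz_inter`).

Now let the inverse slope `h` of the projecting lines run from `-24` to `24`, and think of `h` as
time. The projection `x - h y` of each point of `A` or `B` moves with speed at most `1`; the mass of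
`A` passes from the right of the origin to the left, that of `B` from the left to the right, so
each point of `A` meets each point of `B`. A meeting is wasteful, because the line is hit twice,
but meetings may concentrate on few lines that are hit very often. Concentration is wasteful too,
and bounded speed makes it last. To exploit this, replace the distribution functions of `A` and `B`
by their `4`-Lipschitz minorants (`lipMinorant`). These are Lipschitz in time and place together,
and the planar map `Θ` formed from the two still covers the rectangle `(0, |A|) × (0, |B|)`, by the
intermediate value theorem along a quantile of `A` (`IsMovingCdf.Ioo_prod_Ioo_subset_image`). By
Rademacher's theorem and Sard's lemma the area of the rectangle is at most `8²` times that of the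
set of `(h, r)` at which both minorants have a nonzero derivative (`volume_image_le_of_lipschitz`).
At such a place, either one of the minorants is strict, which by a Vitali covering happens on a
set no larger than `4` times the waste, or `r` lies in the projections of both `A` and `B`, which
happens on a set no larger than the waste (`ParamBarrier.volume_slice_le`). Hence `|A| |B|` is at
most a constant times `ε`, which is absurd.

Curves enter only through their arc-length parametrizations, whose coordinates are Lipschitz
functions of one real variable (`IsRectifiableBarrier.exists_paramBarrier`).
-/

open MeasureTheory Set Filter Topology
open scoped ENNReal NNReal

namespace OpaqueSquare

/-! ### Arc-length parametrization -/

lemma continuous_variationOnFromTo {α E : Type*} [LinearOrder α] [TopologicalSpace α]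
    [OrderTopology α] [PseudoMetricSpace E] {f : α → E} (hf : Continuous f)
    (hv : BoundedVariationOn f univ) (a : α) : Continuous (variationOnFromTo f univ a) := by
  rw [continuous_iff_continuousAt]
  intro b
  rw [continuousAt_iff_continuous_left'_right']
  have hl := variationOnFromTo.tendsto_left (mem_univ a) (mem_univ b)
    hv.locallyBoundedVariationOn (hf.continuousWithinAt (s := univ ∩ Iio b))
  have hr := variationOnFromTo.tendsto_right (mem_univ a) (mem_univ b)
    hv.locallyBoundedVariationOn (hf.continuousWithinAt (s := univ ∩ Ioi b))
  simp only [univ_inter, dist_self, sub_zero, add_zero] at hl hr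
  exact ⟨hl, hr⟩

/-- A rectifiable curve of length `ℓ` is traced by a `1`-Lipschitz map of the real line that takes
only its two end values outside `[0, ℓ]`. -/
lemma Curve.exists_lipschitz_parametrization (c : Curve) (hc : c.IsRectifiable) :
    ∃ g : ℝ → Plane, LipschitzWith 1 g ∧ range g = range c ∧
      ∀ s ∉ Icc 0 c.length.toReal, g s = g 0 ∨ g s = g c.length.toReal := by
  have hv : BoundedVariationOn (fun t : unitInterval => c t) univ := hc.ne
  set v := variationOnFromTo (fun t : unitInterval => c t) univ 0 with hvdef
  have hvc : Continuous v := continuous_variationOnFromTo c.continuous hv 0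
  have hv0 : v 0 = 0 := variationOnFromTo.self _ _ _
  have hv1 : v 1 = c.length.toReal := by
    rw [hvdef, variationOnFromTo.eq_of_le _ _ (zero_le_one' unitInterval), univ_inter]
    congr 1
    exact congrArg _ (eq_univ_of_forall fun t => ⟨unitInterval.nonneg', unitInterval.le_one'⟩)
  have hmono : Monotone v := by
    rw [← monotoneOn_univ]
    exact variationOnFromTo.monotoneOn hv.locallyBoundedVariationOn (mem_univ _)
  have hL : (0 : ℝ) ≤ c.length.toReal := ENNReal.toReal_nonneg
  have hrange : v '' univ = Icc 0 c.length.toReal := by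
    rw [image_univ]
    apply Subset.antisymm
    · rintro _ ⟨t, rfl⟩
      exact ⟨hv0 ▸ hmono unitInterval.nonneg', hv1 ▸ hmono unitInterval.le_one'⟩
    · rw [← hv0, ← hv1]
      exact intermediate_value_univ 0 1 hvc
  set n := naturalParameterization (fun t : unitInterval => c t) univ 0 with hn
  have hun : HasUnitSpeedOn n (Icc 0 c.length.toReal) := by
    rw [← hrange]
    exact has_unit_speed_naturalParameterization _ hv.locallyBoundedVariationOn (mem_univ _)
  have hlip : LipschitzOnWith 1 n (Icc 0 c.length.toReal) := by
    have key : ∀ x ∈ Icc 0 c.length.toReal, ∀ y ∈ Icc 0 c.length.toReal, x ≤ y →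
        edist (n x) (n y) ≤ edist x y := by
      intro x hx y hy hxy
      calc edist (n x) (n y) ≤ eVariationOn n (Icc 0 c.length.toReal ∩ Icc x y) :=
            eVariationOn.edist_le _ ⟨hx, le_rfl, hxy⟩ ⟨hy, hxy, le_rfl⟩
        _ = edist x y := by
            rw [hun hx hy, edist_comm, edist_dist, Real.dist_eq,
              abs_of_nonneg (sub_nonneg.2 hxy), NNReal.coe_one, one_mul]
    intro x hx y hy
    rw [ENNReal.coe_one, one_mul]
    rcases le_total x y with h | h
    · exact key x hx y hy h
    · rw [edist_comm, edist_comm x]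
      exact key y hy x hx h
  have himg : n '' Icc 0 c.length.toReal = range c := by
    rw [← hrange, image_univ, ← range_comp]
    congr 1
    ext1 t
    exact edist_eq_zero.1 (edist_naturalParameterization_eq_zero hv.locallyBoundedVariationOn
      (mem_univ 0) (mem_univ t))
  have hpi : ∀ s, ((projIcc 0 c.length.toReal hL s : Icc 0 c.length.toReal) : ℝ) ∈
      Icc 0 c.length.toReal := fun s => Subtype.coe_prop _
  have himg' : (fun s => n (projIcc 0 c.length.toReal hL s)) '' Icc 0 c.length.toReal
      = range c := by
    rw [← himg]
    exact image_congr fun s hs => by rw [projIcc_of_mem hL hs]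
  refine ⟨fun s => n (projIcc 0 c.length.toReal hL s), ?_, ?_, ?_⟩
  · have h1 : LipschitzWith 1 fun s => (projIcc 0 c.length.toReal hL s : ℝ) := by
      have h := (LipschitzWith.subtype_val (Icc 0 c.length.toReal)).comp (LipschitzWith.projIcc hL)
      rw [one_mul] at h
      exact h
    rw [← lipschitzOnWith_univ] at h1 ⊢
    have h := hlip.comp h1 (fun s _ => hpi s)
    rw [one_mul] at h
    exact h
  · apply Subset.antisymm
    · rintro _ ⟨s, rfl⟩
      rw [← himg]
      exact mem_image_of_mem _ (hpi s)
    · rw [← himg']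
      exact image_subset_range _ _
  · intro s hs
    rcases lt_or_ge s 0 with h | h
    · left
      simp only [projIcc_of_le_left hL h.le, projIcc_left]
    · right
      simp only [projIcc_of_right_le hL (not_le.1 fun h' => hs ⟨h, h'⟩).le, projIcc_right]

/-! ### Projections of a barrier -/

/-- A barrier for the square `[-1/2, 1/2]²` inside `[-1, 1]²`, parametrized by a measure space:
the point with parameter `s` is `(x s, y s)`, the tangent vector there is `(ξ s, η s)`, and `σ`
is the length measure. Only two facts about the underlying curves are retained: linear
functionals do not increase measure by more than their tangential derivative allows, and each
line that meets the square is hit. -/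
structure ParamBarrier (S : Type*) [TopologicalSpace S] [MeasurableSpace S] where
  σ : Measure S
  x : S → ℝ
  y : S → ℝ
  ξ : S → ℝ
  η : S → ℝ
  finite : IsFiniteMeasure σ
  continuous_x : Continuous x
  continuous_y : Continuous y
  measurable_ξ : Measurable ξ
  measurable_η : Measurable η
  speed_le : ∀ s, ξ s ^ 2 + η s ^ 2 ≤ 1
  abs_x_le : ∀ s, |x s| ≤ 1
  abs_y_le : ∀ s, |y s| ≤ 1
  volume_image_le : ∀ (a b : ℝ) (A : Set S), MeasurableSet A →
    volume ((fun s => a * x s + b * y s) '' A) ≤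
      ∫⁻ s in A, ENNReal.ofReal |a * ξ s + b * η s| ∂σ
  exists_eq : ∀ a b r : ℝ, |r| ≤ (|a| + |b|) / 2 → ∃ s, a * x s + b * y s = r

/-- The reflection of a barrier in the diagonal. -/
def ParamBarrier.swap {S : Type*} [TopologicalSpace S] [MeasurableSpace S]
    (P : ParamBarrier S) : ParamBarrier S where
  σ := P.σ
  x := P.y
  y := P.x
  ξ := P.η
  η := P.ξ
  finite := P.finite
  continuous_x := P.continuous_y
  continuous_y := P.continuous_x
  measurable_ξ := P.measurable_η
  measurable_η := P.measurable_ξ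
  speed_le s := by rw [add_comm]; exact P.speed_le s
  abs_x_le := P.abs_y_le
  abs_y_le := P.abs_x_le
  volume_image_le a b A hA := by
    simpa only [add_comm] using P.volume_image_le b a A hA
  exists_eq a b r h := by
    obtain ⟨s, hs⟩ := P.exists_eq b a r (by rwa [add_comm])
    exact ⟨s, by rw [add_comm]; exact hs⟩

lemma volume_image_le_lintegral_abs_deriv {f : ℝ → ℝ} {C : ℝ≥0} (hf : LipschitzWith C f)
    {A : Set ℝ} (hA : MeasurableSet A) :
    volume (f '' A) ≤ ∫⁻ t in A, ENNReal.ofReal |deriv f t| := by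
  set D := {t | DifferentiableAt ℝ f t} with hD
  have hDm : MeasurableSet D := measurableSet_of_differentiableAt ℝ f
  have hnull : volume (f '' (A \ D)) = 0 := by
    have h0 : volume (A \ D) = 0 :=
      measure_mono_null (fun t ht => ht.2) (ae_iff.1 hf.ae_differentiableAt)
    have := hf.hausdorffMeasure_image_le zero_le_one (A \ D)
    rw [hausdorffMeasure_real, h0, mul_zero] at this
    exact le_antisymm this bot_le
  have hdiff : volume (f '' (A ∩ D)) ≤ ∫⁻ t in A ∩ D, ENNReal.ofReal |deriv f t| := by
    have := addHaar_image_le_lintegral_abs_det_fderiv volume (hA.inter hDm)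
      (fun t ht => (ht.2.hasDerivAt.hasDerivWithinAt (s := A ∩ D)).hasFDerivWithinAt)
    simpa only [ContinuousLinearMap.det_toSpanSingleton] using this
  calc volume (f '' A) = volume (f '' (A ∩ D) ∪ f '' (A \ D)) := by
        rw [← image_union, inter_union_sdiff]
    _ ≤ volume (f '' (A ∩ D)) + volume (f '' (A \ D)) := measure_union_le _ _
    _ ≤ ∫⁻ t in A ∩ D, ENNReal.ofReal |deriv f t| := by rw [hnull, add_zero]; exact hdiff
    _ ≤ _ := lintegral_mono_set inter_subset_left

lemma sq_deriv_add_sq_deriv_le {g : ℝ → Plane} (hg : LipschitzWith 1 g) (t : ℝ) :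
    deriv (fun s => g s 0) t ^ 2 + deriv (fun s => g s 1) t ^ 2 ≤ 1 := by
  have hcoord : ∀ i, LipschitzWith 1 fun s => g s i := fun i => by
    apply LipschitzWith.of_dist_le_mul
    intro s s'
    refine le_trans ?_ (hg.dist_le_mul s s')
    rw [Real.dist_eq, dist_eq_norm]
    exact PiLp.norm_apply_le (g s - g s') i
  have hle : ∀ i, deriv (fun s => g s i) t ^ 2 ≤ 1 := fun i => by
    have := norm_deriv_le_of_lipschitz (x₀ := t) (hcoord i)
    rw [Real.norm_eq_abs, NNReal.coe_one] at this
    exact (sq_le_one_iff_abs_le_one _).2 this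
  by_cases h0 : DifferentiableAt ℝ (fun s => g s 0) t
  swap
  · rw [deriv_zero_of_not_differentiableAt h0]
    simpa using hle 1
  by_cases h1 : DifferentiableAt ℝ (fun s => g s 1) t
  swap
  · rw [deriv_zero_of_not_differentiableAt h1]
    simpa using hle 0
  have hd : DifferentiableAt ℝ g t := by
    rw [differentiableAt_euclidean]
    intro i
    fin_cases i
    · exact h0
    · exact h1
  have hi : ∀ i, deriv (fun s => g s i) t = deriv g t i := fun i =>
    ((EuclideanSpace.proj i : Plane →L[ℝ] ℝ).hasFDerivAt.comp_hasDerivAt t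
      hd.hasDerivAt).deriv
  have := norm_deriv_le_of_lipschitz (x₀ := t) hg
  rw [EuclideanSpace.norm_eq, NNReal.coe_one, Real.sqrt_le_one] at this
  simpa [Fin.sum_univ_two, hi] using this

/-- A barrier hits each line that meets the square, in coordinates centred at the square. -/
lemma IsBarrier.exists_mem {Γ : Set Plane} (h : IsBarrier Γ unitSquare) (a b r : ℝ)
    (hr : |r| ≤ (|a| + |b|) / 2) : ∃ p ∈ Γ, a * (p 0 - 1 / 2) + b * (p 1 - 1 / 2) = r := by
  have key : ∀ a b r : ℝ, 0 < |a| + |b| → |r| ≤ (|a| + |b|) / 2 →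
      ∃ p ∈ Γ, a * (p 0 - 1 / 2) + b * (p 1 - 1 / 2) = r := by
    intro a b r hab hr
    set t := r / (|a| + |b|) with ht
    have htabs : |t| ≤ 1 / 2 := by
      rw [ht, abs_div, abs_of_pos hab, div_le_iff₀ hab]
      linarith
    have hs : ∀ z : ℝ, |t * SignType.sign z| ≤ 1 / 2 := fun z => by
      rw [abs_mul]
      rcases lt_trichotomy z 0 with hz | hz | hz
      · simpa [sign_neg hz] using htabs
      · simp [hz]
      · simpa [sign_pos hz] using htabs
    set q : Plane := WithLp.toLp 2 ![1 / 2 + t * SignType.sign a, 1 / 2 + t * SignType.sign b]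
      with hq
    set d : Plane := WithLp.toLp 2 ![-b, a] with hd
    have hd0 : d ≠ 0 := by
      intro h0
      have e0 : d 0 = 0 := by rw [h0]; rfl
      have e1 : d 1 = 0 := by rw [h0]; rfl
      simp only [hd, Matrix.cons_val_zero, Matrix.cons_val_one] at e0 e1
      rw [neg_eq_zero.1 e0, e1] at hab
      simp at hab
    have hline : IsLine (AffineSubspace.mk' q (Submodule.span ℝ {d})) := by
      rw [IsLine, AffineSubspace.direction_mk']
      exact finrank_span_singleton hd0
    obtain ⟨p, hpl, hpΓ⟩ := h _ hline ⟨q, AffineSubspace.self_mem_mk' _ _, by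
      intro i
      fin_cases i
      · have := abs_le.1 (hs a)
        change 1 / 2 + t * (SignType.sign a : ℝ) ∈ Icc 0 1
        rw [mem_Icc]
        constructor <;> linarith
      · have := abs_le.1 (hs b)
        change 1 / 2 + t * (SignType.sign b : ℝ) ∈ Icc 0 1
        rw [mem_Icc]
        constructor <;> linarith⟩
    refine ⟨p, hpΓ, ?_⟩
    rw [SetLike.mem_coe, AffineSubspace.mem_mk', Submodule.mem_span_singleton] at hpl
    obtain ⟨k, hk⟩ := hpl
    rw [vsub_eq_sub] at hk
    have e0 : k * -b = p 0 - (1 / 2 + t * SignType.sign a) := by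
      simpa [hd, hq] using congrArg (fun z : Plane => z 0) hk
    have e1 : k * a = p 1 - (1 / 2 + t * SignType.sign b) := by
      simpa [hd, hq] using congrArg (fun z : Plane => z 1) hk
    have ea : a * SignType.sign a = |a| := by rw [mul_comm]; exact sign_mul_self a
    have eb : b * SignType.sign b = |b| := by rw [mul_comm]; exact sign_mul_self b
    have et : t * (|a| + |b|) = r := div_mul_cancel₀ _ hab.ne'
    linear_combination a * (-e0) + b * (-e1) + t * ea + t * eb + et
  rcases (add_nonneg (abs_nonneg a) (abs_nonneg b)).eq_or_lt with h0 | h0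
  · obtain ⟨p, hp, -⟩ := key 1 0 0 (by simp) (by simp)
    have ha : a = 0 := abs_eq_zero.1 (by linarith [abs_nonneg a, abs_nonneg b])
    have hb : b = 0 := abs_eq_zero.1 (by linarith [abs_nonneg a, abs_nonneg b])
    have hr0 : r = 0 := abs_eq_zero.1 (le_antisymm (by linarith) (abs_nonneg r))
    exact ⟨p, hp, by simp [ha, hb, hr0]⟩
  · exact key a b r h0 hr

/-- A rectifiable barrier near the square, as a `ParamBarrier` over the disjoint union of the
arc-length parameter intervals of its curves. -/
lemma IsRectifiableBarrier.exists_paramBarrier {ι : Type*} [TopologicalSpace ι]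
    [DiscreteTopology ι] [MeasurableSpace ι] [DiscreteMeasurableSpace ι] {γ : ι → Curve}
    (hγ : IsRectifiableBarrier γ unitSquare) (hloc : trace γ ⊆ doubleSquare) :
    ∃ P : ParamBarrier (ι × ℝ), P.σ univ = totalLength γ := by
  have := hγ.countable
  choose g hlip hrange hend using fun i =>
    (γ i).exists_lipschitz_parametrization (hγ.rectifiable i)
  set L : ι → ℝ := fun i => (γ i).length.toReal with hL
  set σ : Measure (ι × ℝ) :=
    Measure.sum fun i => (volume.restrict (Icc 0 (L i))).map (Prod.mk i) with hσ
  have hmk : ∀ i : ι, Measurable (Prod.mk i : ℝ → ι × ℝ) := fun i => measurable_prodMk_left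
  have hσu : σ univ = totalLength γ := by
    rw [hσ, Measure.sum_apply _ MeasurableSet.univ, totalLength]
    congr 1
    ext1 i
    rw [Measure.map_apply (hmk i) MeasurableSet.univ, preimage_univ, Measure.restrict_apply_univ,
      Real.volume_Icc, sub_zero, hL, ENNReal.ofReal_toReal (hγ.rectifiable i).ne]
  have hmem : ∀ s : ι × ℝ, g s.1 s.2 ∈ trace γ := fun s =>
    mem_iUnion.2 ⟨s.1, hrange s.1 ▸ mem_range_self _⟩
  have hbd : ∀ (s : ι × ℝ) (j : Fin 2), |g s.1 s.2 j - 1 / 2| ≤ 1 := fun s j => by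
    obtain ⟨h1, h2⟩ := hloc (hmem s) j
    rw [abs_le]
    constructor <;> linarith
  have hcoord : ∀ i j, LipschitzWith 1 fun s => g i s j := fun i j =>
    LipschitzWith.of_dist_le_mul fun s s' => by
      refine le_trans ?_ ((hlip i).dist_le_mul s s')
      rw [Real.dist_eq, dist_eq_norm]
      exact PiLp.norm_apply_le (g i s - g i s') j
  have hcont : ∀ j : Fin 2, Continuous fun s : ι × ℝ => g s.1 s.2 j - 1 / 2 := fun j => by
    rw [continuous_prod_of_discrete_left]
    intro i
    exact (hcoord i j).continuous.sub continuous_const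
  have hmeas : ∀ j : Fin 2, Measurable fun s : ι × ℝ => deriv (fun t => g s.1 t j) s.2 := fun j =>
    measurable_from_prod_countable_right fun i => measurable_deriv fun t => g i t j
  refine ⟨{
    σ := σ
    x := fun s => g s.1 s.2 0 - 1 / 2
    y := fun s => g s.1 s.2 1 - 1 / 2
    ξ := fun s => deriv (fun t => g s.1 t 0) s.2
    η := fun s => deriv (fun t => g s.1 t 1) s.2
    finite := ⟨hσu ▸ hγ.totalLength_lt_top⟩
    continuous_x := hcont 0
    continuous_y := hcont 1
    measurable_ξ := hmeas 0
    measurable_η := hmeas 1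
    speed_le := fun s => sq_deriv_add_sq_deriv_le (hlip s.1) s.2
    abs_x_le := fun s => hbd s 0
    abs_y_le := fun s => hbd s 1
    volume_image_le := ?_
    exists_eq := ?_ }, hσu⟩
  · intro a b A hA
    set f : ι → ℝ → ℝ := fun i t => a * (g i t 0 - 1 / 2) + b * (g i t 1 - 1 / 2) with hf
    have hflip : ∀ i, LipschitzWith (‖a‖₊ * 1 + ‖b‖₊ * 1) (f i) := fun i => by
      have h0 := ((lipschitzWith_smul a).comp ((hcoord i 0).sub (LipschitzWith.const (1 / 2))))
      have h1 := ((lipschitzWith_smul b).comp ((hcoord i 1).sub (LipschitzWith.const (1 / 2))))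
      rw [add_zero] at h0 h1
      exact h0.add h1
    set Ai : ι → Set ℝ := fun i => Prod.mk i ⁻¹' A with hAi
    have hAim : ∀ i, MeasurableSet (Ai i) := fun i => hmk i hA
    have himage : (fun s : ι × ℝ => a * (g s.1 s.2 0 - 1 / 2) + b * (g s.1 s.2 1 - 1 / 2)) '' A
        = ⋃ i, f i '' Ai i := by
      ext r
      simp only [mem_image, mem_iUnion, Prod.exists, hAi, hf, mem_preimage]
    rw [himage]
    refine (measure_iUnion_le _).trans ?_
    rw [hσ, Measure.restrict_sum _ hA, lintegral_sum_measure]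
    refine ENNReal.tsum_le_tsum fun i => ?_
    rw [Measure.restrict_map (hmk i) hA, lintegral_map (by
      exact ((((hmeas 0).const_mul a).add ((hmeas 1).const_mul b)).abs).ennreal_ofReal) (hmk i)]
    rw [Measure.restrict_restrict (hAim i)]
    -- Outside the parameter interval, `g i` takes only the two end values.
    have hsub : f i '' Ai i ⊆ f i '' (Ai i ∩ Icc 0 (L i)) ∪ {f i 0, f i (L i)} := by
      rintro _ ⟨t, ht, rfl⟩
      by_cases h : t ∈ Icc 0 (L i)
      · exact Or.inl ⟨t, ⟨ht, h⟩, rfl⟩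
      · right
        rcases hend i t h with h | h
        · left; simp only [hf, h]
        · right; simp only [hf, h, hL, mem_singleton_iff]
    have hpair : volume ({f i 0, f i (L i)} : Set ℝ) = 0 := (toFinite _).measure_zero _
    calc volume (f i '' Ai i)
        ≤ volume (f i '' (Ai i ∩ Icc 0 (L i))) + volume ({f i 0, f i (L i)} : Set ℝ) :=
          (measure_mono hsub).trans (measure_union_le _ _)
      _ = volume (f i '' (Ai i ∩ Icc 0 (L i))) := by rw [hpair, add_zero]
      _ ≤ ∫⁻ t in Ai i ∩ Icc 0 (L i), ENNReal.ofReal |deriv (f i) t| :=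
          volume_image_le_lintegral_abs_deriv (hflip i) ((hAim i).inter measurableSet_Icc)
      _ ≤ _ := by
          refine lintegral_mono_ae (ae_restrict_of_ae ?_)
          filter_upwards [(hcoord i 0).ae_differentiableAt, (hcoord i 1).ae_differentiableAt]
            with t h0 h1
          have hder : deriv (f i) t = a * deriv (fun t => g i t 0) t + b * deriv (fun t => g i t 1) t :=
            (((h0.hasDerivAt.sub_const (1 / 2)).const_mul a).add
              ((h1.hasDerivAt.sub_const (1 / 2)).const_mul b)).deriv
          rw [hder]
  · intro a b r hr
    obtain ⟨p, hp, hpr⟩ := hγ.isBarrier.exists_mem a b r hr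
    obtain ⟨i, hi⟩ := mem_iUnion.1 hp
    rw [← hrange i] at hi
    obtain ⟨t, rfl⟩ := hi
    exact ⟨(i, t), hpr⟩

namespace ParamBarrier

variable {S : Type*} [TopologicalSpace S] [MeasurableSpace S]

/-- The value at the barrier point `s` of the linear functional with coefficients `a`, `b`. -/
def proj (P : ParamBarrier S) (a b : ℝ) (s : S) : ℝ := a * P.x s + b * P.y s

/-- The absolute tangential derivative of the linear functional with coefficients `a`, `b`. -/
def dens (P : ParamBarrier S) (a b : ℝ) (s : S) : ℝ := |a * P.ξ s + b * P.η s|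

/-- The projection of the length measure by the linear functional with coefficients `a`, `b`,
each piece being counted with the length of its projection. -/
noncomputable def push (P : ParamBarrier S) (a b : ℝ) : Measure ℝ :=
  (P.σ.withDensity fun s => ENNReal.ofReal (P.dens a b s)).map (P.proj a b)

/-- The total length of the barrier. -/
noncomputable def len (P : ParamBarrier S) : ℝ := P.σ.real univ

/-- The total length of the projections of the pieces of the barrier exceeds the width of the
square by this amount. -/
noncomputable def waste (P : ParamBarrier S) (a b : ℝ) : ℝ :=
  ∫ s, P.dens a b s ∂P.σ - (|a| + |b|)

variable (P : ParamBarrier S)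

lemma abs_ξ_le (s : S) : |P.ξ s| ≤ 1 :=
  (sq_le_one_iff_abs_le_one _).1 (by nlinarith [P.speed_le s, sq_nonneg (P.η s)])

lemma abs_η_le (s : S) : |P.η s| ≤ 1 :=
  (sq_le_one_iff_abs_le_one _).1 (by nlinarith [P.speed_le s, sq_nonneg (P.ξ s)])

lemma measurable_dens (a b : ℝ) : Measurable (P.dens a b) :=
  ((P.measurable_ξ.const_mul a).add (P.measurable_η.const_mul b)).abs

lemma dens_nonneg (a b : ℝ) (s : S) : 0 ≤ P.dens a b s := abs_nonneg _

lemma dens_le (a b : ℝ) (s : S) : P.dens a b s ≤ |a| + |b| := by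
  refine (abs_add_le _ _).trans (add_le_add ?_ ?_) <;> rw [abs_mul]
  · exact mul_le_of_le_one_right (abs_nonneg a) (P.abs_ξ_le s)
  · exact mul_le_of_le_one_right (abs_nonneg b) (P.abs_η_le s)

lemma abs_proj_le (a b : ℝ) (s : S) : |P.proj a b s| ≤ |a| + |b| := by
  refine (abs_add_le _ _).trans (add_le_add ?_ ?_) <;> rw [abs_mul]
  · exact mul_le_of_le_one_right (abs_nonneg a) (P.abs_x_le s)
  · exact mul_le_of_le_one_right (abs_nonneg b) (P.abs_y_le s)

lemma continuous_proj (a b : ℝ) : Continuous (P.proj a b) :=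
  (P.continuous_x.const_mul a).add (P.continuous_y.const_mul b)

lemma integrable_of_abs_le {f : S → ℝ} (hf : Measurable f) {C : ℝ} (hC : ∀ s, |f s| ≤ C) :
    Integrable f P.σ := by
  have := P.finite
  exact Integrable.of_bound hf.aestronglyMeasurable C (ae_of_all _ hC)

lemma integrable_dens (a b : ℝ) : Integrable (P.dens a b) P.σ :=
  P.integrable_of_abs_le (P.measurable_dens a b) fun s => by
    rw [abs_of_nonneg (P.dens_nonneg a b s)]; exact P.dens_le a b s

section

variable [BorelSpace S]

lemma measurable_x : Measurable P.x := P.continuous_x.measurable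

lemma measurable_y : Measurable P.y := P.continuous_y.measurable

lemma measurable_proj (a b : ℝ) : Measurable (P.proj a b) := (P.continuous_proj a b).measurable

lemma push_apply (a b : ℝ) {E : Set ℝ} (hE : MeasurableSet E) :
    P.push a b E = ∫⁻ s in P.proj a b ⁻¹' E, ENNReal.ofReal (P.dens a b s) ∂P.σ := by
  rw [push, Measure.map_apply (P.measurable_proj a b) hE,
    withDensity_apply _ (P.measurable_proj a b hE)]

/-- The projected length measure dominates Lebesgue measure on the projection of the square. -/
lemma restrict_le_push (a b : ℝ) :
    volume.restrict (Icc (-((|a| + |b|) / 2)) ((|a| + |b|) / 2)) ≤ P.push a b := by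
  rw [Measure.le_iff]
  intro E hE
  rw [Measure.restrict_apply hE, P.push_apply a b hE]
  refine (measure_mono ?_).trans (P.volume_image_le a b _ (P.measurable_proj a b hE))
  rintro r ⟨hrE, hr⟩
  obtain ⟨s, hs⟩ := P.exists_eq a b r (abs_le.2 hr)
  exact ⟨s, show P.proj a b s ∈ E from (show P.proj a b s = r from hs) ▸ hrE, hs⟩

lemma push_univ (a b : ℝ) :
    P.push a b univ = ENNReal.ofReal (P.waste a b + (|a| + |b|)) := by
  rw [P.push_apply a b MeasurableSet.univ, preimage_univ, Measure.restrict_univ, waste,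
    sub_add_cancel, ofReal_integral_eq_lintegral_ofReal (P.integrable_dens a b)
      (ae_of_all _ (P.dens_nonneg a b))]

lemma integral_le_integral_dens (a b : ℝ) {φ : ℝ → ℝ} (hφ : Continuous φ)
    (h0 : ∀ r, |r| ≤ |a| + |b| → 0 ≤ φ r) :
    ∫ r in (-((|a| + |b|) / 2))..((|a| + |b|) / 2), φ r
      ≤ ∫ s, φ (P.proj a b s) * P.dens a b s ∂P.σ := by
  have hw : 0 ≤ (|a| + |b|) / 2 := by positivity
  obtain ⟨C, hC⟩ := (isCompact_Icc (a := -(|a| + |b|)) (b := |a| + |b|)).exists_bound_of_continuousOn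
    hφ.continuousOn
  have hmeas : Measurable fun s => φ (P.proj a b s) * P.dens a b s :=
    (hφ.measurable.comp (P.measurable_proj a b)).mul (P.measurable_dens a b)
  have hint : Integrable (fun s => φ (P.proj a b s) * P.dens a b s) P.σ := by
    refine P.integrable_of_abs_le hmeas (C := C * (|a| + |b|)) fun s => ?_
    rw [abs_mul, abs_of_nonneg (P.dens_nonneg a b s)]
    have h1 := hC _ (abs_le.1 (P.abs_proj_le a b s))
    exact mul_le_mul h1 (P.dens_le a b s) (P.dens_nonneg a b s) ((norm_nonneg _).trans h1)
  have hnn : ∀ s, 0 ≤ φ (P.proj a b s) * P.dens a b s := fun s =>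
    mul_nonneg (h0 _ (P.abs_proj_le a b s)) (P.dens_nonneg a b s)
  rw [intervalIntegral.integral_of_le (by linarith), ← integral_Icc_eq_integral_Ioc,
    ← ENNReal.ofReal_le_ofReal_iff (integral_nonneg hnn),
    ofReal_integral_eq_lintegral_ofReal hint (ae_of_all _ hnn),
    ofReal_integral_eq_lintegral_ofReal hφ.integrableOn_Icc]
  · calc ∫⁻ r in Icc (-((|a| + |b|) / 2)) ((|a| + |b|) / 2), ENNReal.ofReal (φ r)
        ≤ ∫⁻ r, ENNReal.ofReal (φ r) ∂P.push a b := lintegral_mono' (P.restrict_le_push a b) le_rfl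
      _ = ∫⁻ s, ENNReal.ofReal (P.dens a b s) * ENNReal.ofReal (φ (P.proj a b s)) ∂P.σ := by
          rw [push, lintegral_map hφ.measurable.ennreal_ofReal (P.measurable_proj a b)]
          exact lintegral_withDensity_eq_lintegral_mul _ (P.measurable_dens a b).ennreal_ofReal
            (hφ.measurable.comp (P.measurable_proj a b)).ennreal_ofReal
      _ = _ := by
          congr 1
          ext1 s
          rw [← ENNReal.ofReal_mul (P.dens_nonneg a b s), mul_comm]
  · refine (ae_restrict_iff' measurableSet_Icc).2 (ae_of_all _ fun r hr => h0 r ?_)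
    have := abs_le.2 hr
    linarith [abs_nonneg a, abs_nonneg b]

lemma waste_nonneg (a b : ℝ) : 0 ≤ P.waste a b := by
  have := P.integral_le_integral_dens a b (φ := fun _ => 1) continuous_const
    fun _ _ => zero_le_one
  simp only [intervalIntegral.integral_const, one_mul, smul_eq_mul, mul_one] at this
  rw [waste]
  linarith

/-- A set that the projected length measure covers at least twice is no larger than the waste. -/
lemma volume_le_waste (a b : ℝ) {E : Set ℝ} (hE : MeasurableSet E)
    (h : 2 * volume E ≤ P.push a b E) : volume E ≤ ENNReal.ofReal (P.waste a b) := by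
  set w := |a| + |b| with hw
  have hw0 : 0 ≤ w := by positivity
  set I := Icc (-(w / 2)) (w / 2) with hI
  have hIv : volume I = ENNReal.ofReal w := by rw [hI, Real.volume_Icc]; congr 1; ring
  have hfin : P.push a b univ ≠ ∞ := by rw [push_univ]; exact ENNReal.ofReal_ne_top
  have hEfin : volume E ≠ ∞ := by
    intro htop
    rw [htop] at h
    exact hfin (top_le_iff.1 (le_trans (by simp) (h.trans (measure_mono (subset_univ E)))))
  have hc : volume (Eᶜ ∩ I) ≤ P.push a b Eᶜ := by
    have := P.restrict_le_push a b Eᶜ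
    rwa [Measure.restrict_apply hE.compl] at this
  have hsum : P.push a b E + P.push a b Eᶜ = ENNReal.ofReal (P.waste a b) + volume I := by
    rw [measure_add_measure_compl hE, push_univ, hIv, ENNReal.ofReal_add (P.waste_nonneg a b) hw0]
  have hsplit : volume I ≤ volume E + volume (Eᶜ ∩ I) := by
    refine (measure_mono ?_).trans (measure_union_le E (Eᶜ ∩ I))
    intro r hr
    by_cases hrE : r ∈ E
    · exact Or.inl hrE
    · exact Or.inr ⟨hrE, hr⟩
  have hIfin : volume I ≠ ∞ := by rw [hIv]; exact ENNReal.ofReal_ne_top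
  have hfin2 : volume (Eᶜ ∩ I) ≠ ∞ :=
    ((measure_mono inter_subset_right).trans_lt hIfin.lt_top).ne
  have key : volume E + (volume E + volume (Eᶜ ∩ I)) ≤
      ENNReal.ofReal (P.waste a b) + (volume E + volume (Eᶜ ∩ I)) :=
    calc volume E + (volume E + volume (Eᶜ ∩ I)) = 2 * volume E + volume (Eᶜ ∩ I) := by ring
      _ ≤ P.push a b E + P.push a b Eᶜ := add_le_add h hc
      _ ≤ _ := hsum.trans_le (add_le_add le_rfl hsplit)
  exact (ENNReal.add_le_add_iff_right (ENNReal.add_ne_top.2 ⟨hEfin, hfin2⟩)).1 key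

end

end ParamBarrier

lemma indicator_one_nonneg {S : Type*} (A : Set S) (s : S) : (0 : ℝ) ≤ A.indicator 1 s :=
  Set.indicator_nonneg (fun _ _ => zero_le_one) s

lemma indicator_one_le {S : Type*} (A : Set S) (s : S) : A.indicator 1 s ≤ (1 : ℝ) :=
  Set.indicator_le' (fun _ _ => le_rfl) (fun _ _ => zero_le_one) s

namespace ParamBarrier

variable {S : Type*} [TopologicalSpace S] [MeasurableSpace S] (P : ParamBarrier S)

/-! ### Moments of a short barrier -/

/-- The part of the barrier whose direction is nearly horizontal. The tolerance `10⁻⁸` is small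
enough for the estimates of moments, and large against the excess length `10⁻¹²`. -/
def horiz : Set S := {s | 1 - 1 / 10 ^ 8 < |P.ξ s|}

/-- The part of the barrier whose direction is nearly vertical. -/
def vert : Set S := {s | 1 - 1 / 10 ^ 8 < |P.η s|}

/-- The part of the barrier whose direction is far from both axes. -/
def slanted : Set S := (P.horiz ∪ P.vert)ᶜ

lemma measurableSet_horiz : MeasurableSet P.horiz :=
  measurableSet_lt measurable_const P.measurable_ξ.abs

lemma measurableSet_vert : MeasurableSet P.vert :=
  measurableSet_lt measurable_const P.measurable_η.abs

lemma measurableSet_slanted : MeasurableSet P.slanted :=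
  (P.measurableSet_horiz.union P.measurableSet_vert).compl

lemma abs_η_le_of_mem_horiz {s : S} (hs : s ∈ P.horiz) : |P.η s| ≤ 15 / 10 ^ 5 := by
  have h1 : 1 - 1 / 10 ^ 8 < |P.ξ s| := hs
  have h2 := P.speed_le s
  rw [← sq_abs (P.ξ s)] at h2
  exact abs_le_of_sq_le_sq (by nlinarith) (by norm_num)

lemma abs_ξ_le_of_mem_vert {s : S} (hs : s ∈ P.vert) : |P.ξ s| ≤ 15 / 10 ^ 5 :=
  P.swap.abs_η_le_of_mem_horiz hs

lemma notMem_vert_of_mem_horiz {s : S} (hs : s ∈ P.horiz) : s ∉ P.vert := fun h => by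
  have h1 := P.abs_η_le_of_mem_horiz hs
  have h2 : 1 - 1 / 10 ^ 8 < |P.η s| := h
  norm_num at h1 h2
  linarith

lemma indicator_add_indicator_add_indicator (s : S) :
    P.horiz.indicator 1 s + P.vert.indicator 1 s + P.slanted.indicator 1 s = (1 : ℝ) := by
  by_cases h : s ∈ P.horiz
  · have h2 := P.notMem_vert_of_mem_horiz h
    simp [h, h2, slanted]
  · by_cases h2 : s ∈ P.vert <;> simp [h, h2, slanted]

/-- A bound for the deviation of the tangential densities from those of a barrier that consists
of horizontal and vertical segments. -/
noncomputable def err (s : S) : ℝ := 2 / 10 ^ 4 + P.slanted.indicator 1 s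

lemma measurable_err : Measurable P.err :=
  measurable_const.add (measurable_one.indicator P.measurableSet_slanted)

lemma abs_dens_one_zero_sub_le (s : S) :
    |P.dens 1 0 s - P.horiz.indicator 1 s| ≤ P.err s := by
  have h0 : P.dens 1 0 s = |P.ξ s| := by simp [dens]
  have h1 := P.abs_ξ_le s
  have h3 := abs_nonneg (P.ξ s)
  rw [h0, err, abs_le]
  by_cases h : s ∈ P.horiz
  · have h2 : 1 - 1 / 10 ^ 8 < |P.ξ s| := h
    have h4 : s ∉ P.slanted := fun h' => h' (Or.inl h)
    norm_num [h, h4] at h2 ⊢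
    constructor <;> linarith
  · by_cases h' : s ∈ P.vert
    · have h2 := P.abs_ξ_le_of_mem_vert h'
      have h4 : s ∉ P.slanted := fun h'' => h'' (Or.inr h')
      norm_num [h, h4] at h2 ⊢
      constructor <;> linarith
    · have h4 : s ∈ P.slanted := fun h'' => h''.elim h h'
      norm_num [h, h4] at h1 ⊢
      constructor <;> linarith

lemma abs_dens_diag_sub_le (s : S) {b : ℝ} (hb : |b| = 1) :
    |P.dens 1 b s - 1| ≤ P.err s := by
  have h1 := P.abs_ξ_le s
  have h2 := P.abs_η_le s
  have hb' : |b * P.η s| = |P.η s| := by rw [abs_mul, hb, one_mul]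
  have h3 : P.dens 1 b s ≤ |P.ξ s| + |P.η s| := by
    rw [dens, one_mul, ← hb']
    exact abs_add_le _ _
  have h4 : |P.ξ s| - |P.η s| ≤ P.dens 1 b s := by
    rw [dens, one_mul, ← hb']
    have := abs_sub_abs_le_abs_sub (P.ξ s) (-(b * P.η s))
    rwa [abs_neg, sub_neg_eq_add] at this
  have h5 : |P.η s| - |P.ξ s| ≤ P.dens 1 b s := by
    rw [dens, one_mul, ← hb', add_comm]
    have := abs_sub_abs_le_abs_sub (b * P.η s) (-(P.ξ s))
    rwa [abs_neg, sub_neg_eq_add] at this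
  have h6 := P.dens_nonneg 1 b s
  rw [err, abs_le]
  by_cases h : s ∈ P.horiz
  · have h7 : 1 - 1 / 10 ^ 8 < |P.ξ s| := h
    have h8 := P.abs_η_le_of_mem_horiz h
    have h9 : s ∉ P.slanted := fun h' => h' (Or.inl h)
    norm_num [h9] at h7 h8 ⊢
    constructor <;> linarith
  · by_cases h' : s ∈ P.vert
    · have h7 : 1 - 1 / 10 ^ 8 < |P.η s| := h'
      have h8 := P.abs_ξ_le_of_mem_vert h'
      have h9 : s ∉ P.slanted := fun h' => h' (by right; assumption)
      norm_num [h9] at h7 h8 ⊢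
      constructor <;> linarith
    · have h9 : s ∈ P.slanted := fun h'' => h''.elim h h'
      norm_num [h9]
      constructor <;> linarith

lemma integrable_mul_indicator {f : S → ℝ} (hf : Measurable f) {C : ℝ} (hC : ∀ s, |f s| ≤ C)
    {A : Set S} (hA : MeasurableSet A) : Integrable (fun s => f s * A.indicator 1 s) P.σ :=
  P.integrable_of_abs_le (hf.mul (measurable_one.indicator hA)) (C := C) fun s => by
    rw [abs_mul, abs_of_nonneg (indicator_one_nonneg A s)]
    exact (mul_le_of_le_one_right (abs_nonneg _) (indicator_one_le A s)).trans (hC s)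

lemma integral_indicator_eq {A : Set S} (hA : MeasurableSet A) :
    ∫ s, A.indicator 1 s ∂P.σ = P.σ.real A := by
  rw [integral_indicator_one hA]

section

variable [BorelSpace S]

lemma two_le_integral_max : 2 ≤ ∫ s, max |P.ξ s| |P.η s| ∂P.σ := by
  have h1 := P.waste_nonneg 1 1
  have h2 := P.waste_nonneg 1 (-1)
  have h3 : ∫ s, max |P.ξ s| |P.η s| ∂P.σ =
      (∫ s, P.dens 1 1 s ∂P.σ + ∫ s, P.dens 1 (-1) s ∂P.σ) / 2 := by
    rw [← integral_add (P.integrable_dens _ _) (P.integrable_dens _ _), ← integral_div]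
    congr 1
    ext1 s
    simp only [dens, one_mul, neg_mul]
    -- `|ξ + η| + |ξ - η| = 2 max |ξ| |η|`
    grind
  simp only [waste, abs_one, abs_neg] at h1 h2
  linarith

lemma two_le_len : 2 ≤ P.len := by
  refine P.two_le_integral_max.trans ?_
  have := P.finite
  have h : ∫ _, (1 : ℝ) ∂P.σ = P.len := by simp [len]
  rw [← h]
  refine integral_mono (P.integrable_of_abs_le (P.measurable_ξ.abs.max P.measurable_η.abs)
    (C := 1) fun s => ?_) (integrable_const _) fun s => max_le (P.abs_ξ_le s) (P.abs_η_le s)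
  rw [abs_of_nonneg (le_max_of_le_left (abs_nonneg _))]
  exact max_le (P.abs_ξ_le s) (P.abs_η_le s)

/-- By the projections to the two diagonals, almost all of a short barrier is nearly parallel to
an axis. -/
lemma real_slanted_le (hL : P.len < 2 + 1 / 10 ^ 12) : P.σ.real P.slanted ≤ 1 / 10 ^ 4 := by
  have := P.finite
  have hint : Integrable (fun s => max |P.ξ s| |P.η s|) P.σ :=
    P.integrable_of_abs_le (P.measurable_ξ.abs.max P.measurable_η.abs) (C := 1) fun s => by
      rw [abs_of_nonneg (le_max_of_le_left (abs_nonneg _))]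
      exact max_le (P.abs_ξ_le s) (P.abs_η_le s)
  have h1 : ∫ s, (1 - max |P.ξ s| |P.η s|) ∂P.σ ≤ 1 / 10 ^ 12 := by
    rw [integral_sub (integrable_const _) hint]
    have h2 := P.two_le_integral_max
    have h : ∫ _, (1 : ℝ) ∂P.σ = P.len := by simp [len]
    linarith
  have h2 := mul_meas_ge_le_integral_of_nonneg (μ := P.σ)
    (f := fun s => 1 - max |P.ξ s| |P.η s|)
    (ae_of_all _ fun s => sub_nonneg.2 (max_le (P.abs_ξ_le s) (P.abs_η_le s)))
    ((integrable_const _).sub hint) (1 / 10 ^ 8)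
  have h3 : {s | 1 / 10 ^ 8 ≤ 1 - max |P.ξ s| |P.η s|} = P.slanted := by
    ext s
    simp only [slanted, horiz, vert, mem_compl_iff, mem_union, mem_ofPred_eq, not_or, not_lt]
    rw [le_sub_comm, max_le_iff]
  rw [h3] at h2
  norm_num at h1 h2 ⊢
  linarith

lemma integral_err_le (hL : P.len < 2 + 1 / 10 ^ 12) : ∫ s, P.err s ∂P.σ ≤ 1 / 10 ^ 3 := by
  have := P.finite
  have h1 := P.real_slanted_le hL
  have h2 : ∫ s, P.err s ∂P.σ = 2 / 10 ^ 4 * P.len + P.σ.real P.slanted := by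
    rw [← P.integral_indicator_eq P.measurableSet_slanted]
    have := integral_add (μ := P.σ) (integrable_const ((2 : ℝ) / 10 ^ 4))
      ((integrable_const (1 : ℝ)).indicator P.measurableSet_slanted)
    simp only [integral_const, smul_eq_mul] at this
    rw [len, mul_comm]
    exact this
  norm_num at h1 h2 hL ⊢
  linarith

/-- The projection inequality for test functions, with the tangential density replaced by its
value `g` for a barrier of horizontal and vertical segments. -/
lemma integral_le_integral_mul (hL : P.len < 2 + 1 / 10 ^ 12) (a b : ℝ) {φ : ℝ → ℝ} {C w : ℝ}
    (hφ : Continuous φ) (hw : |a| + |b| = w) (h0 : ∀ r, |r| ≤ w → 0 ≤ φ r ∧ φ r ≤ C)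
    {g : S → ℝ} (hgm : Measurable g) (hg : ∀ s, |P.dens a b s - g s| ≤ P.err s) :
    ∫ r in (-(w / 2))..(w / 2), φ r ≤
      ∫ s, φ (P.proj a b s) * g s ∂P.σ + C * (1 / 10 ^ 3) := by
  subst hw
  have hφs : ∀ s, 0 ≤ φ (P.proj a b s) ∧ φ (P.proj a b s) ≤ C := fun s =>
    h0 _ (P.abs_proj_le a b s)
  have hφm : Measurable fun s => φ (P.proj a b s) := hφ.measurable.comp (P.measurable_proj a b)
  have hφa : ∀ s, |φ (P.proj a b s)| ≤ C := fun s => by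
    rw [abs_of_nonneg (hφs s).1]; exact (hφs s).2
  have herr : ∀ s, 0 ≤ P.err s ∧ P.err s ≤ 2 := fun s => by
    have h1 := indicator_one_nonneg P.slanted s
    have h2 := indicator_one_le P.slanted s
    rw [err]
    norm_num
    constructor <;> linarith
  have hC : 0 ≤ C := by
    have := h0 0 (by rw [abs_zero]; positivity)
    exact this.1.trans this.2
  have hga : ∀ s, |g s| ≤ |a| + |b| + 2 := fun s => by
    have h1 := abs_le.1 (hg s)
    have h2 := P.dens_le a b s
    have h3 := P.dens_nonneg a b s
    have h4 := (herr s).2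
    rw [abs_le]
    constructor <;> linarith [abs_nonneg a, abs_nonneg b]
  have hi1 : Integrable (fun s => φ (P.proj a b s) * g s) P.σ :=
    P.integrable_of_abs_le (hφm.mul hgm) (C := C * (|a| + |b| + 2)) fun s => by
      rw [abs_mul]
      exact mul_le_mul (hφa s) (hga s) (abs_nonneg _) hC
  have hi2 : Integrable (fun s => C * P.err s) P.σ :=
    (P.integrable_of_abs_le P.measurable_err (C := 2) fun s => by
      rw [abs_of_nonneg (herr s).1]; exact (herr s).2).const_mul C
  have hi3 : Integrable (fun s => φ (P.proj a b s) * P.dens a b s) P.σ :=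
    P.integrable_of_abs_le (hφm.mul (P.measurable_dens a b)) (C := C * (|a| + |b|)) fun s => by
      rw [abs_mul, abs_of_nonneg (P.dens_nonneg a b s)]
      exact mul_le_mul (hφa s) (P.dens_le a b s) (P.dens_nonneg a b s) hC
  calc ∫ r in (-((|a| + |b|) / 2))..((|a| + |b|) / 2), φ r
      ≤ ∫ s, φ (P.proj a b s) * P.dens a b s ∂P.σ :=
        P.integral_le_integral_dens a b hφ fun r hr => (h0 r hr).1
    _ ≤ ∫ s, (φ (P.proj a b s) * g s + C * P.err s) ∂P.σ := by
        refine integral_mono hi3 (hi1.add hi2) fun s => ?_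
        have h1 := (abs_le.1 (hg s)).2
        have h2 := mul_le_mul_of_nonneg_left h1 (hφs s).1
        have h3 := mul_le_mul_of_nonneg_right (hφs s).2 (herr s).1
        simp only
        linarith
    _ = ∫ s, φ (P.proj a b s) * g s ∂P.σ + C * ∫ s, P.err s ∂P.σ := by
        rw [integral_add hi1 hi2, integral_const_mul]
    _ ≤ _ := by
        have := mul_le_mul_of_nonneg_left (P.integral_err_le hL) hC
        linarith

end

end ParamBarrier

namespace ParamBarrier

variable {S : Type*} [TopologicalSpace S] [MeasurableSpace S] (P : ParamBarrier S)

lemma abs_x_sq_le (s : S) : |P.x s ^ 2| ≤ 1 := by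
  rw [abs_pow]; exact pow_le_one₀ (abs_nonneg _) (P.abs_x_le s)

lemma abs_y_sq_le (s : S) : |P.y s ^ 2| ≤ 1 := P.swap.abs_x_sq_le s

lemma integrable_indicator {A : Set S} (hA : MeasurableSet A) :
    Integrable (A.indicator (1 : S → ℝ)) P.σ := by
  have := P.finite
  exact (integrable_const (1 : ℝ)).indicator hA

lemma integral_eq_sum_indicator {f : S → ℝ} (hf : Measurable f) {C : ℝ} (hC : ∀ s, |f s| ≤ C) :
    ∫ s, f s ∂P.σ = ∫ s, f s * P.horiz.indicator 1 s ∂P.σ + ∫ s, f s * P.vert.indicator 1 s ∂P.σ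
      + ∫ s, f s * P.slanted.indicator 1 s ∂P.σ := by
  have h1 := P.integrable_mul_indicator hf hC P.measurableSet_horiz
  have h2 := P.integrable_mul_indicator hf hC P.measurableSet_vert
  have h3 := P.integrable_mul_indicator hf hC P.measurableSet_slanted
  have h12 : Integrable (fun s => f s * P.horiz.indicator 1 s + f s * P.vert.indicator 1 s) P.σ :=
    h1.add h2
  rw [← integral_add h1 h2, ← integral_add h12 h3]
  congr 1
  ext1 s
  rw [← mul_add, ← mul_add, P.indicator_add_indicator_add_indicator, mul_one]

lemma real_add_real_le : P.σ.real P.horiz + P.σ.real P.vert ≤ P.len := by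
  have := P.finite
  rw [← measureReal_union (disjoint_left.2 fun _ => P.notMem_vert_of_mem_horiz)
    P.measurableSet_vert]
  exact measureReal_mono (subset_univ _)

variable [BorelSpace S]

lemma integrable_x : Integrable P.x P.σ := P.integrable_of_abs_le P.measurable_x P.abs_x_le

lemma integrable_y : Integrable P.y P.σ := P.integrable_of_abs_le P.measurable_y P.abs_y_le

lemma integrable_x_sq : Integrable (fun s => P.x s ^ 2) P.σ :=
  P.integrable_of_abs_le (P.measurable_x.pow_const 2) P.abs_x_sq_le

lemma integrable_y_sq : Integrable (fun s => P.y s ^ 2) P.σ := P.swap.integrable_x_sq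

lemma integrable_mul : Integrable (fun s => P.x s * P.y s) P.σ :=
  P.integrable_of_abs_le (P.measurable_x.mul P.measurable_y) (C := 1) fun s => by
    rw [abs_mul]; exact mul_le_one₀ (P.abs_x_le s) (abs_nonneg _) (P.abs_y_le s)

lemma abs_integral_mul_slanted_le (hL : P.len < 2 + 1 / 10 ^ 12) {f : S → ℝ}
    (hf : ∀ s, |f s| ≤ 1) : |∫ s, f s * P.slanted.indicator 1 s ∂P.σ| ≤ 1 / 10 ^ 3 := by
  refine (norm_integral_le_of_norm_le (G := ℝ) (P.integrable_indicator P.measurableSet_slanted)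
    (ae_of_all _ fun s => ?_)).trans ?_
  · rw [norm_mul, Real.norm_eq_abs, Real.norm_eq_abs, abs_of_nonneg (indicator_one_nonneg _ s)]
    exact mul_le_of_le_one_left (indicator_one_nonneg _ s) (hf s)
  · rw [P.integral_indicator_eq P.measurableSet_slanted]
    exact (P.real_slanted_le hL).trans (by norm_num)

lemma le_real_horiz (hL : P.len < 2 + 1 / 10 ^ 12) : 1 - 1 / 10 ^ 3 ≤ P.σ.real P.horiz := by
  have h := P.integral_le_integral_mul hL 1 0 (φ := fun _ => 1) (C := 1) (w := 1) continuous_const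
    (by simp) (fun r _ => ⟨zero_le_one, le_rfl⟩)
    (measurable_one.indicator P.measurableSet_horiz) P.abs_dens_one_zero_sub_le
  simp only [one_mul, P.integral_indicator_eq P.measurableSet_horiz,
    intervalIntegral.integral_const, smul_eq_mul] at h
  norm_num at h ⊢
  linarith

lemma le_real_vert (hL : P.len < 2 + 1 / 10 ^ 12) : 1 - 1 / 10 ^ 3 ≤ P.σ.real P.vert :=
  P.swap.le_real_horiz hL

lemma real_horiz_le (hL : P.len < 2 + 1 / 10 ^ 12) : P.σ.real P.horiz ≤ 1 + 2 / 10 ^ 3 := by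
  have h1 := P.le_real_vert hL
  have h2 := P.real_add_real_le
  norm_num at h1 h2 hL ⊢
  linarith

lemma integral_x_sq_mul_horiz_le (hL : P.len < 2 + 1 / 10 ^ 12) :
    ∫ s, P.x s ^ 2 * P.horiz.indicator 1 s ∂P.σ ≤ 1 / 12 + 3 / 10 ^ 3 := by
  have h := P.integral_le_integral_mul hL 1 0 (φ := fun r => 1 - r ^ 2) (C := 1) (w := 1)
    (by fun_prop) (by simp)
    (fun r hr => by
      have := (sq_le_one_iff_abs_le_one r).2 hr
      constructor <;> nlinarith)
    (measurable_one.indicator P.measurableSet_horiz) P.abs_dens_one_zero_sub_le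
  have h1 : ∫ r in (-(1 / 2 : ℝ))..(1 / 2), (1 - r ^ 2) = 11 / 12 := by
    rw [intervalIntegral.integral_sub (by simp) (by simp)]
    norm_num
  have h2 : ∫ s, (1 - P.proj 1 0 s ^ 2) * P.horiz.indicator 1 s ∂P.σ =
      P.σ.real P.horiz - ∫ s, P.x s ^ 2 * P.horiz.indicator 1 s ∂P.σ := by
    rw [← P.integral_indicator_eq P.measurableSet_horiz, ← integral_sub
      (P.integrable_indicator P.measurableSet_horiz)
      (P.integrable_mul_indicator (P.measurable_x.pow_const 2) P.abs_x_sq_le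
        P.measurableSet_horiz)]
    congr 1
    ext1 s
    simp only [proj]
    ring
  rw [h1, h2] at h
  have h3 := P.real_horiz_le hL
  norm_num at h h3 ⊢
  linarith

lemma abs_integral_x_mul_horiz_le (hL : P.len < 2 + 1 / 10 ^ 12) :
    |∫ s, P.x s * P.horiz.indicator 1 s ∂P.σ| ≤ 4 / 10 ^ 3 := by
  have key : ∀ e : ℝ, |e| = 1 →
      1 ≤ P.σ.real P.horiz + e * ∫ s, P.x s * P.horiz.indicator 1 s ∂P.σ + 2 / 10 ^ 3 := by
    intro e he
    have h := P.integral_le_integral_mul hL 1 0 (φ := fun r => 1 + e * r) (C := 2) (w := 1)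
      (by fun_prop) (by simp)
      (fun r hr => by
        have : |e * r| ≤ 1 := by rwa [abs_mul, he, one_mul]
        have := abs_le.1 this
        constructor <;> linarith)
      (measurable_one.indicator P.measurableSet_horiz) P.abs_dens_one_zero_sub_le
    have h1 : ∫ r in (-(1 / 2 : ℝ))..(1 / 2), (1 + e * r) = 1 := by
      rw [intervalIntegral.integral_add (by simp) (Continuous.intervalIntegrable (by fun_prop) _ _),
        intervalIntegral.integral_const_mul, integral_id]
      norm_num
    have h2 : ∫ s, (1 + e * P.proj 1 0 s) * P.horiz.indicator 1 s ∂P.σ =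
        P.σ.real P.horiz + e * ∫ s, P.x s * P.horiz.indicator 1 s ∂P.σ := by
      rw [← P.integral_indicator_eq P.measurableSet_horiz, ← integral_const_mul, ← integral_add
        (P.integrable_indicator P.measurableSet_horiz)
        ((P.integrable_mul_indicator P.measurable_x P.abs_x_le P.measurableSet_horiz).const_mul e)]
      congr 1
      ext1 s
      simp only [proj]
      ring
    rw [h1, h2] at h
    norm_num at h ⊢
    linarith
  have h1 := key 1 (by simp)
  have h2 := key (-1) (by simp)
  have h3 := P.real_horiz_le hL
  rw [abs_le]
  norm_num at h1 h2 h3 ⊢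
  constructor <;> linarith

/-- The second moment of a short barrier is at least that of the boundary of the square, taken
with half density. -/
lemma le_integral_x_sq_add_y_sq (hL : P.len < 2 + 1 / 10 ^ 12) :
    2 / 3 - 4 / 10 ^ 3 ≤ ∫ s, P.x s ^ 2 ∂P.σ + ∫ s, P.y s ^ 2 ∂P.σ := by
  have key : ∀ b : ℝ, |b| = 1 → 2 / 3 ≤ ∫ s, P.x s ^ 2 ∂P.σ + ∫ s, P.y s ^ 2 ∂P.σ
      + 2 * b * ∫ s, P.x s * P.y s ∂P.σ + 4 / 10 ^ 3 := by
    intro b hb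
    have h := P.integral_le_integral_mul hL 1 b (φ := fun r => r ^ 2) (C := 4) (w := 2)
      (by fun_prop) (by rw [hb, abs_one]; norm_num)
      (fun r hr => ⟨sq_nonneg r, by nlinarith [abs_nonneg r, sq_abs r]⟩)
      measurable_const (fun s => P.abs_dens_diag_sub_le s hb)
    have h1 : ∫ r in (-(2 / 2 : ℝ))..(2 / 2), r ^ 2 = 2 / 3 := by
      norm_num
    have hb2 : b ^ 2 = 1 := by rw [← sq_abs, hb, one_pow]
    have h2 : ∫ s, P.proj 1 b s ^ 2 * 1 ∂P.σ = ∫ s, P.x s ^ 2 ∂P.σ + ∫ s, P.y s ^ 2 ∂P.σ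
        + 2 * b * ∫ s, P.x s * P.y s ∂P.σ := by
      have hi : Integrable (fun s => P.x s ^ 2 + P.y s ^ 2) P.σ :=
        P.integrable_x_sq.add P.integrable_y_sq
      rw [← integral_const_mul, ← integral_add P.integrable_x_sq P.integrable_y_sq,
        ← integral_add hi (P.integrable_mul.const_mul _)]
      congr 1
      ext1 s
      simp only [proj]
      linear_combination P.y s ^ 2 * hb2
    rw [h1, h2] at h
    norm_num at h ⊢
    linarith
  have h1 := key 1 (by simp)
  have h2 := key (-1) (by simp)
  norm_num at h1 h2 ⊢
  linarith

lemma abs_integral_y_le (hL : P.len < 2 + 1 / 10 ^ 12) :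
    |∫ s, P.y s ∂P.σ| ≤ 5 / 10 ^ 3 := by
  have := P.finite
  have key : ∀ b e : ℝ, |b| = 1 → |e| = 1 → 4 ≤ 2 * P.len
      + (e * ∫ s, P.x s ∂P.σ + e * b * ∫ s, P.y s ∂P.σ) + 4 / 10 ^ 3 := by
    intro b e hb he
    have h := P.integral_le_integral_mul hL 1 b (φ := fun r => 2 + e * r) (C := 4) (w := 2)
      (by fun_prop) (by rw [hb, abs_one]; norm_num)
      (fun r hr => by
        have : |e * r| ≤ 2 := by rwa [abs_mul, he, one_mul]
        have := abs_le.1 this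
        constructor <;> linarith)
      measurable_const (fun s => P.abs_dens_diag_sub_le s hb)
    have h1 : ∫ r in (-(2 / 2 : ℝ))..(2 / 2), (2 + e * r) = 4 := by
      rw [intervalIntegral.integral_add (by simp) (Continuous.intervalIntegrable (by fun_prop) _ _),
        intervalIntegral.integral_const_mul, integral_id]
      norm_num
    have h2 : ∫ s, (2 + e * P.proj 1 b s) * 1 ∂P.σ = 2 * P.len
      + (e * ∫ s, P.x s ∂P.σ + e * b * ∫ s, P.y s ∂P.σ) := by
      have h3 : ∫ _, (2 : ℝ) ∂P.σ = 2 * P.len := by simp [len, mul_comm]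
      have hi : Integrable (fun s => e * P.x s + e * b * P.y s) P.σ :=
        (P.integrable_x.const_mul _).add (P.integrable_y.const_mul _)
      rw [← integral_const_mul, ← integral_const_mul, ← h3,
        ← integral_add (P.integrable_x.const_mul _) (P.integrable_y.const_mul _),
        ← integral_add (integrable_const _) hi]
      congr 1
      ext1 s
      simp only [proj]
      ring
    rw [h1, h2] at h
    norm_num at h ⊢
    linarith
  have h1 := key 1 1 (by simp) (by simp)
  have h2 := key 1 (-1) (by simp) (by simp)
  have h3 := key (-1) 1 (by simp) (by simp)
  have h4 := key (-1) (-1) (by simp) (by simp)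
  rw [abs_le]
  norm_num at h1 h2 h3 h4 hL ⊢
  constructor <;> linarith

lemma abs_integral_y_mul_horiz_le (hL : P.len < 2 + 1 / 10 ^ 12) :
    |∫ s, P.y s * P.horiz.indicator 1 s ∂P.σ| ≤ 1 / 10 ^ 2 := by
  have h1 := P.integral_eq_sum_indicator P.measurable_y P.abs_y_le
  have h2 := abs_le.1 (P.abs_integral_y_le hL)
  have h3 := abs_le.1 (P.abs_integral_mul_slanted_le hL P.abs_y_le)
  have h4 : |∫ s, P.y s * P.vert.indicator 1 s ∂P.σ| ≤ 4 / 10 ^ 3 :=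
    P.swap.abs_integral_x_mul_horiz_le hL
  have h5 := abs_le.1 h4
  rw [abs_le]
  norm_num at h1 h2 h3 h5 ⊢
  constructor <;> linarith

/-- The second moments force the nearly horizontal part away from the horizontal axis, or the
nearly vertical part away from the vertical axis. -/
lemma le_integral_y_sq_or (hL : P.len < 2 + 1 / 10 ^ 12) :
    1 / 4 - 6 / 10 ^ 3 ≤ ∫ s, P.y s ^ 2 * P.horiz.indicator 1 s ∂P.σ ∨
      1 / 4 - 6 / 10 ^ 3 ≤ ∫ s, P.x s ^ 2 * P.vert.indicator 1 s ∂P.σ := by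
  have h1 := P.le_integral_x_sq_add_y_sq hL
  have h2 := P.integral_eq_sum_indicator (P.measurable_x.pow_const 2) P.abs_x_sq_le
  have h3 := P.integral_eq_sum_indicator (P.measurable_y.pow_const 2) P.abs_y_sq_le
  have h4 := (abs_le.1 (P.abs_integral_mul_slanted_le hL P.abs_x_sq_le)).2
  have h5 := (abs_le.1 (P.abs_integral_mul_slanted_le hL P.abs_y_sq_le)).2
  have h6 := P.integral_x_sq_mul_horiz_le hL
  have h7 : ∫ s, P.y s ^ 2 * P.vert.indicator 1 s ∂P.σ ≤ 1 / 12 + 3 / 10 ^ 3 :=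
    P.swap.integral_x_sq_mul_horiz_le hL
  by_contra! h
  obtain ⟨h8, h9⟩ := h
  norm_num at h1 h2 h3 h4 h5 h6 h7 h8 h9
  linarith

/-- A set of horizontal pieces with mean height near `0` and large second moment has many pieces
above and many pieces below the square's middle. -/
lemma lt_real_horiz_inter (hL : P.len < 2 + 1 / 10 ^ 12)
    (h : 1 / 4 - 6 / 10 ^ 3 ≤ ∫ s, P.y s ^ 2 * P.horiz.indicator 1 s ∂P.σ) {e : ℝ}
    (he : |e| = 1) : 1 / 20 < P.σ.real (P.horiz ∩ {s | 1 / 16 < e * P.y s}) := by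
  set A := P.horiz ∩ {s | 1 / 16 < e * P.y s} with hA
  have hAm : MeasurableSet A := P.measurableSet_horiz.inter
    (measurableSet_lt measurable_const (P.measurable_y.const_mul e))
  have hi1 := P.integrable_mul_indicator (P.measurable_y.pow_const 2) P.abs_y_sq_le
    P.measurableSet_horiz
  have hi2 := P.integrable_mul_indicator P.measurable_y P.abs_y_le P.measurableSet_horiz
  have hi3 := P.integrable_indicator hAm
  have hi4 := P.integrable_indicator P.measurableSet_horiz
  have h1 := abs_le.1 (P.abs_integral_y_mul_horiz_le hL)
  have h2 := P.real_horiz_le hL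
  -- On the horizontal part, `(y² + e y) / 2` is at most `1` on `A` and at most `1/16` off `A`.
  have key : ∫ s, (1 / 2 * (P.y s ^ 2 * P.horiz.indicator 1 s)
      + e / 2 * (P.y s * P.horiz.indicator 1 s)) ∂P.σ ≤
      ∫ s, (A.indicator 1 s + 1 / 16 * P.horiz.indicator 1 s) ∂P.σ := by
    refine integral_mono ((hi1.const_mul _).add (hi2.const_mul _)) (hi3.add (hi4.const_mul _))
      fun s => ?_
    have hy : |e * P.y s| ≤ 1 := by rw [abs_mul, he, one_mul]; exact P.abs_y_le s
    have hy2 : P.y s ^ 2 = (e * P.y s) ^ 2 := by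
      rw [mul_pow, ← sq_abs e, he, one_pow, one_mul]
    obtain ⟨h3, h4⟩ := abs_le.1 hy
    have h5 : e / 2 * P.y s = (e * P.y s) / 2 := by ring
    by_cases hs : s ∈ P.horiz
    · by_cases hs' : 1 / 16 < e * P.y s
      · have : s ∈ A := ⟨hs, hs'⟩
        simp only [hs, this, indicator_of_mem, Pi.one_apply, mul_one, hy2, h5]
        nlinarith
      · have : s ∉ A := fun h => hs' h.2
        simp only [hs, this, indicator_of_mem, indicator_of_notMem, not_false_eq_true,
          Pi.one_apply, mul_one, hy2, h5]
        rw [not_lt] at hs'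
        nlinarith
    · have : s ∉ A := fun h => hs h.1
      simp [hs, this]
  rw [integral_add (hi1.const_mul _) (hi2.const_mul _), integral_add hi3 (hi4.const_mul _),
    integral_const_mul, integral_const_mul, integral_const_mul, P.integral_indicator_eq hAm,
    P.integral_indicator_eq P.measurableSet_horiz] at key
  rcases eq_or_eq_neg_of_abs_eq he with rfl | rfl
  all_goals
    norm_num at key h1 h2 h ⊢
    linarith

end ParamBarrier

/-! ### Sweeping distribution functions -/

/-- `F h` is the distribution function at time `h` of a mass of total at most `α` that moves
along the real line with speed at most `1`. -/
structure IsMovingCdf (F : ℝ → ℝ → ℝ) (α : ℝ) : Prop where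
  mono : ∀ h, Monotone (F h)
  nonneg : ∀ h r, 0 ≤ F h r
  le : ∀ h r, F h r ≤ α
  shift : ∀ h h' r, F h' r ≤ F h (r + |h' - h|)

/-- The largest minorant of `F h` with Lipschitz constant `4`, as a function of time and place.
It is the distribution function that arises when concentrated mass is spread to the right until
its density is at most `4`. -/
noncomputable def lipMinorant (F : ℝ → ℝ → ℝ) (z : ℝ × ℝ) : ℝ := ⨅ r, F z.1 r + 4 * |z.2 - r|

namespace IsMovingCdf

variable {F G : ℝ → ℝ → ℝ} {α β : ℝ}

lemma bddBelow (hF : IsMovingCdf F α) (z : ℝ × ℝ) :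
    BddBelow (range fun r => F z.1 r + 4 * |z.2 - r|) :=
  ⟨0, by rintro _ ⟨r, rfl⟩; have := hF.nonneg z.1 r; positivity⟩

lemma lipMinorant_le_add (hF : IsMovingCdf F α) (h r r' : ℝ) :
    lipMinorant F (h, r) ≤ F h r' + 4 * |r - r'| := ciInf_le (hF.bddBelow (h, r)) r'

lemma lipMinorant_le (hF : IsMovingCdf F α) (h r : ℝ) : lipMinorant F (h, r) ≤ F h r := by
  simpa using hF.lipMinorant_le_add h r r

lemma lipMinorant_nonneg (hF : IsMovingCdf F α) (z : ℝ × ℝ) : 0 ≤ lipMinorant F z :=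
  le_ciInf fun r => by have := hF.nonneg z.1 r; positivity

lemma lipMinorant_shift (hF : IsMovingCdf F α) (h h' r : ℝ) :
    lipMinorant F (h', r) ≤ lipMinorant F (h, r + |h' - h|) := by
  refine le_ciInf fun q => (hF.lipMinorant_le_add h' r (q - |h' - h|)).trans ?_
  have h1 := hF.shift h h' (q - |h' - h|)
  rw [sub_add_cancel] at h1
  have h2 : r - (q - |h' - h|) = r + |h' - h| - q := by ring
  rw [h2]
  exact add_le_add h1 le_rfl

lemma lipMinorant_le_right (hF : IsMovingCdf F α) (h r r' : ℝ) :
    lipMinorant F (h, r) ≤ lipMinorant F (h, r') + 4 * |r - r'| := by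
  rw [← sub_le_iff_le_add]
  refine le_ciInf fun q => ?_
  have h1 := hF.lipMinorant_le_add h r q
  have h2 := abs_sub_le r r' q
  simp only
  linarith

lemma lipMinorant_mono (hF : IsMovingCdf F α) (h : ℝ) {r r' : ℝ} (hr : r ≤ r') :
    lipMinorant F (h, r) ≤ lipMinorant F (h, r') := by
  refine le_ciInf fun q => (hF.lipMinorant_le_add h r (q - (r' - r))).trans ?_
  have h1 := hF.mono h (show q - (r' - r) ≤ q by linarith)
  have h2 : r - (q - (r' - r)) = r' - q := by ring
  rw [h2]
  exact add_le_add h1 le_rfl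

lemma lipschitzWith_lipMinorant (hF : IsMovingCdf F α) : LipschitzWith 8 (lipMinorant F) := by
  refine LipschitzWith.of_le_add_mul 8 fun z z' => ?_
  obtain ⟨h, r⟩ := z
  obtain ⟨h', r'⟩ := z'
  have h1 := hF.lipMinorant_shift h' h r
  have h2 := hF.lipMinorant_le_right h' (r + |h - h'|) r'
  have h3 : |r + |h - h'| - r'| ≤ |r - r'| + |h - h'| := by
    have := abs_add_le (r - r') |h - h'|
    rw [abs_abs] at this
    rwa [show r + |h - h'| - r' = r - r' + |h - h'| by ring]
  have h4 : |h - h'| ≤ dist (h, r) (h', r') := by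
    rw [← Real.dist_eq]; exact le_max_left _ _
  have h5 : |r - r'| ≤ dist (h, r) (h', r') := by
    rw [← Real.dist_eq]; exact le_max_right _ _
  norm_num
  linarith

/-- Where the minorant agrees with `F` and there is no mass immediately to the right, the
minorant has a local maximum. -/
lemma fderiv_lipMinorant_eq_zero (hF : IsMovingCdf F α) {h r ε : ℝ} (hε : 0 < ε)
    (heq : F h r ≤ lipMinorant F (h, r)) (hflat : F h (r + ε) ≤ F h r) :
    fderiv ℝ (lipMinorant F) (h, r) = 0 := by
  refine IsLocalMax.fderiv_eq_zero ?_
  have hc : ∀ᶠ z : ℝ × ℝ in 𝓝 (h, r), z.2 + |z.1 - h| < r + ε := by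
    have : Continuous fun z : ℝ × ℝ => z.2 + |z.1 - h| := by fun_prop
    exact this.continuousAt.eventually_lt continuousAt_const (by simpa using hε)
  filter_upwards [hc] with z hz
  calc lipMinorant F z ≤ F z.1 z.2 := hF.lipMinorant_le z.1 z.2
    _ ≤ F h (z.2 + |z.1 - h|) := hF.shift h z.1 z.2
    _ ≤ F h (r + ε) := hF.mono h hz.le
    _ ≤ F h r := hflat
    _ ≤ _ := heq

lemma lipMinorant_eq_of_gap (hF : IsMovingCdf F α) {h δ : ℝ} (hα : α ≤ 4 * δ)
    (hfull : ∀ r, -δ ≤ r → α ≤ F h r) : α ≤ lipMinorant F (h, 0) := by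
  refine le_ciInf fun q => ?_
  have h0 := hF.nonneg h q
  rcases le_or_gt (-δ) q with hq | hq
  · have := hfull q hq
    have : 0 ≤ 4 * |0 - q| := by positivity
    simp only
    linarith
  · have : δ ≤ |0 - q| := by rw [zero_sub]; exact le_trans (by linarith) (le_abs_self _)
    simp only
    linarith

/-- Suppose that between the times `-K` and `K` the mass `F` moves from the right of the origin
to the left, and `G` from the left to the right. Then each quantile of `F` meets each quantile
of `G`. -/
lemma Ioo_prod_Ioo_subset_image (hF : IsMovingCdf F α) (hG : IsMovingCdf G β) {K δ : ℝ}
    (hK : 0 ≤ K) (hδ : 0 < δ) (hα : α ≤ 4 * δ) (hβ : β ≤ 4 * δ)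
    (hF0 : ∀ r < δ, F (-K) r = 0) (hF1 : ∀ r, -δ ≤ r → F K r = α)
    (hG0 : ∀ r < δ, G K r = 0) (hG1 : ∀ r, -δ ≤ r → G (-K) r = β) :
    Ioo 0 α ×ˢ Ioo 0 β ⊆
      (fun z => (lipMinorant F z, lipMinorant G z)) '' (Icc (-K) K ×ˢ univ) := by
  rintro ⟨u, v⟩ ⟨⟨hu0, huα⟩, hv0, hvβ⟩
  simp only at hu0 huα hv0 hvβ
  set f := lipMinorant F with hf
  set g := lipMinorant G with hg
  have hfc : Continuous f := hF.lipschitzWith_lipMinorant.continuous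
  have hgc : Continuous g := hG.lipschitzWith_lipMinorant.continuous
  set T : ℝ → Set ℝ := fun h => {r | u ≤ f (h, r)} with hT
  set X : ℝ → ℝ := fun h => sInf (T h) with hX
  have hTne : ∀ h, (T h).Nonempty := fun h => by
    refine ⟨0 + |K - h|, ?_⟩
    calc u ≤ α := huα.le
      _ ≤ f (K, 0) := hF.lipMinorant_eq_of_gap hα fun r hr => (hF1 r hr).ge
      _ ≤ _ := hF.lipMinorant_shift h K 0
  have hf0 : ∀ r < 0, f (-K, r) = 0 := fun r hr =>
    le_antisymm ((hF.lipMinorant_le _ _).trans (hF0 r (hr.trans hδ)).le)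
      (hF.lipMinorant_nonneg _)
  have hTbdd : ∀ h, BddBelow (T h) := fun h => by
    refine ⟨-|h - -K|, fun r hr => ?_⟩
    by_contra! hlt
    have h1 : u ≤ f (-K, r + |h - -K|) := le_trans hr (hF.lipMinorant_shift (-K) h r)
    rw [hf0 _ (by linarith)] at h1
    linarith
  have hTcl : ∀ h, IsClosed (T h) := fun h =>
    isClosed_le continuous_const (hfc.comp (by fun_prop))
  have hXle : ∀ h, u ≤ f (h, X h) := fun h => (hTcl h).csInf_mem (hTne h) (hTbdd h)
  have hXeq : ∀ h, f (h, X h) = u := fun h => by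
    refine le_antisymm (le_of_forall_pos_le_add fun ε hε => ?_) (hXle h)
    have h1 : f (h, X h - ε / 4) < u := by
      by_contra! hle
      have := csInf_le (hTbdd h) (show X h - ε / 4 ∈ T h from hle)
      simp only [hX] at this
      linarith
    have h2 := hF.lipMinorant_le_right h (X h) (X h - ε / 4)
    rw [sub_sub_cancel, abs_of_pos (by positivity)] at h2
    linarith
  have hXlip : LipschitzWith 1 X := LipschitzWith.of_le_add fun h h' => by
    rw [← sub_le_iff_le_add]
    refine le_csInf (hTne h') fun r hr => ?_
    rw [sub_le_iff_le_add]
    refine csInf_le (hTbdd h) ?_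
    have h1 := hF.lipMinorant_shift h h' r
    rw [← Real.dist_eq, dist_comm] at h1
    exact le_trans hr h1
  have hcont : Continuous fun h => g (h, X h) :=
    hgc.comp (continuous_id.prodMk hXlip.continuous)
  have hstart : v ≤ g (-K, X (-K)) := by
    have h0 : 0 ≤ X (-K) := le_csInf (hTne _) fun r hr => by
      by_contra! hlt
      have h1 : u ≤ f (-K, r) := hr
      rw [hf0 r hlt] at h1
      linarith
    exact hvβ.le.trans ((hG.lipMinorant_eq_of_gap hβ fun r hr => (hG1 r hr).ge).trans
      (hG.lipMinorant_mono _ h0))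
  have hend : g (K, X K) ≤ v := by
    have h0 : X K ≤ 0 := csInf_le (hTbdd _)
      (huα.le.trans (hF.lipMinorant_eq_of_gap hα fun r hr => (hF1 r hr).ge))
    refine ((hG.lipMinorant_le _ _).trans ?_).trans hv0.le
    rw [hG0 _ (by linarith)]
  obtain ⟨h, hh, hgv⟩ := intermediate_value_Icc' (by linarith : -K ≤ K) hcont.continuousOn
    ⟨hend, hstart⟩
  exact ⟨(h, X h), ⟨hh, mem_univ _⟩, Prod.ext (hXeq h) hgv⟩

end IsMovingCdf

lemma det_eq_zero_of_not_surjective {A : ℝ × ℝ →L[ℝ] ℝ × ℝ} (hA : ¬ Function.Surjective A) :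
    A.det = 0 := by
  by_contra h
  exact hA (LinearMap.equivOfDetNeZero (A : ℝ × ℝ →ₗ[ℝ] ℝ × ℝ) h).surjective

/-- A pair of Lipschitz functions maps a set to a null set, up to the points where both have a
nonzero derivative: Rademacher's theorem and Sard's lemma. -/
lemma volume_image_le_of_lipschitz {f g : ℝ × ℝ → ℝ} (hf : LipschitzWith 8 f)
    (hg : LipschitzWith 8 g) (s : Set (ℝ × ℝ)) :
    volume ((fun z => (f z, g z)) '' s) ≤
      64 * volume (s ∩ {z | fderiv ℝ f z ≠ 0 ∧ fderiv ℝ g z ≠ 0}) := by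
  set Θ : ℝ × ℝ → ℝ × ℝ := fun z => (f z, g z) with hΘ
  have hlip : LipschitzWith 8 Θ := by simpa using hf.prodMk hg
  have himage : ∀ t, volume (Θ '' t) ≤ 64 * volume t := fun t => by
    have := hlip.hausdorffMeasure_image_le (d := 2) zero_le_two t
    rw [hausdorffMeasure_prod_real] at this
    convert this using 2
    norm_num
  set E := {z | fderiv ℝ f z ≠ 0 ∧ fderiv ℝ g z ≠ 0} with hE
  set N := {z | ¬ (DifferentiableAt ℝ f z ∧ DifferentiableAt ℝ g z)} with hN
  have hNnull : volume N = 0 := by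
    rw [hN, ← ae_iff]
    exact hf.ae_differentiableAt.and hg.ae_differentiableAt
  have hNimage : volume (Θ '' N) = 0 :=
    le_antisymm ((himage N).trans (by rw [hNnull, mul_zero])) bot_le
  have hsard : volume (Θ '' (Nᶜ ∩ Eᶜ)) = 0 := by
    refine addHaar_image_eq_zero_of_det_fderivWithin_eq_zero volume
      (f' := fun z => (fderiv ℝ f z).prod (fderiv ℝ g z)) (fun z hz => ?_) fun z hz => ?_
    · obtain ⟨h1, h2⟩ := not_not.1 hz.1
      exact (h1.hasFDerivAt.prodMk h2.hasFDerivAt).hasFDerivWithinAt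
    · refine det_eq_zero_of_not_surjective fun hsurj => hz.2 ⟨fun h0 => ?_, fun h0 => ?_⟩
      · obtain ⟨w, hw⟩ := hsurj (1, 0)
        have := congrArg Prod.fst hw
        simp [h0] at this
      · obtain ⟨w, hw⟩ := hsurj (0, 1)
        have := congrArg Prod.snd hw
        simp [h0] at this
  have hsub : Θ '' s ⊆ Θ '' (s ∩ E) ∪ (Θ '' N ∪ Θ '' (Nᶜ ∩ Eᶜ)) := by
    rw [← image_union, ← image_union]
    refine image_mono fun z hz => ?_
    by_cases h1 : z ∈ E
    · exact Or.inl ⟨hz, h1⟩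
    · by_cases h2 : z ∈ N
      · exact Or.inr (Or.inl h2)
      · exact Or.inr (Or.inr ⟨h2, h1⟩)
  calc volume (Θ '' s) ≤ volume (Θ '' (s ∩ E)) + (volume (Θ '' N) + volume (Θ '' (Nᶜ ∩ Eᶜ))) :=
        (measure_mono hsub).trans ((measure_union_le _ _).trans
          (add_le_add le_rfl (measure_union_le _ _)))
    _ = volume (Θ '' (s ∩ E)) := by rw [hNimage, hsard, add_zero, add_zero]
    _ ≤ _ := himage _

namespace ParamBarrier

variable {S : Type*} [TopologicalSpace S] [MeasurableSpace S] (P : ParamBarrier S)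

/-! ### Lines of a given slope -/

/-- The distribution function of the length of the part `A` of the barrier under the projection
`(x, y) ↦ x - h y` along the lines of inverse slope `h`. -/
noncomputable def cdf (A : Set S) (h r : ℝ) : ℝ := P.σ.real (A ∩ {s | P.proj 1 (-h) s ≤ r})

lemma isMovingCdf_cdf (A : Set S) : IsMovingCdf (P.cdf A) (P.σ.real A) := by
  have := P.finite
  refine ⟨fun h r r' hr => ?_, fun h r => measureReal_nonneg,
    fun h r => measureReal_mono inter_subset_left, fun h h' r => ?_⟩
  · exact measureReal_mono (inter_subset_inter_right _ fun s hs => le_trans hs hr)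
  · refine measureReal_mono (inter_subset_inter_right _ fun s hs => ?_)
    have h1 : P.proj 1 (-h') s ≤ r := hs
    have h2 : P.proj 1 (-h) s ≤ r + |h' - h| := by
      have h3 : (h' - h) * P.y s ≤ |h' - h| := by
        refine (le_abs_self _).trans ?_
        rw [abs_mul]
        exact mul_le_of_le_one_right (abs_nonneg _) (P.abs_y_le s)
      have h4 : P.proj 1 (-h) s = P.proj 1 (-h') s + (h' - h) * P.y s := by
        simp only [proj]; ring
      linarith
    exact h2

/-- The right end points of the intervals on which the length measure of `A`, projected along the
lines of inverse slope `h`, has mean density more than `4`. -/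
def crowded (A : Set S) (h : ℝ) : Set ℝ :=
  {r | ∃ q < r, P.cdf A h q + 4 * (r - q) < P.cdf A h r}

/-- The spread-out distribution function varies only at crowded places and on the projection. -/
lemma mem_crowded_or_mem_image {A : Set S} (hA : IsCompact A) {h r : ℝ}
    (hr : fderiv ℝ (lipMinorant (P.cdf A)) (h, r) ≠ 0) :
    r ∈ P.crowded A h ∨ r ∈ P.proj 1 (-h) '' A := by
  have hcdf := P.isMovingCdf_cdf A
  by_contra! hcon
  obtain ⟨hcr, him⟩ := hcon
  have hopen : IsOpen (P.proj 1 (-h) '' A)ᶜ :=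
    (hA.image (P.continuous_proj 1 (-h))).isClosed.isOpen_compl
  obtain ⟨ε, hε, hball⟩ := Metric.isOpen_iff.1 hopen r him
  refine hr (hcdf.fderiv_lipMinorant_eq_zero (half_pos hε) (le_ciInf fun q => ?_) ?_)
  · simp only
    rcases le_or_gt r q with hq | hq
    · have := hcdf.mono h hq
      have : 0 ≤ 4 * |r - q| := by positivity
      linarith
    · rw [abs_of_pos (sub_pos.2 hq)]
      by_contra! hlt
      exact hcr ⟨q, hq, hlt⟩
  · have := P.finite
    refine measureReal_mono ?_
    rintro s ⟨hs, hsr⟩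
    refine ⟨hs, ?_⟩
    have hsr' : P.proj 1 (-h) s ≤ r + ε / 2 := hsr
    by_contra! hgt
    have hgt' : r < P.proj 1 (-h) s := not_le.1 hgt
    refine hball ?_ ⟨s, hs, rfl⟩
    rw [Metric.mem_ball, Real.dist_eq, abs_of_pos (sub_pos.2 hgt')]
    linarith

lemma half_le_dens {s : S} (hs : s ∈ P.horiz) {h : ℝ} (hh : h ∈ Icc (-24 : ℝ) 24) :
    1 / 2 ≤ P.dens 1 (-h) s := by
  have h1 : 1 - 1 / 10 ^ 8 < |P.ξ s| := hs
  have h2 := P.abs_η_le_of_mem_horiz hs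
  have h3 : |h * P.η s| ≤ 24 * (15 / 10 ^ 5) := by
    rw [abs_mul]
    exact mul_le_mul (abs_le.2 hh) h2 (abs_nonneg _) (by norm_num)
  have h4 := abs_sub_abs_le_abs_sub (P.ξ s) (h * P.η s)
  have h5 : P.dens 1 (-h) s = |P.ξ s - h * P.η s| := by rw [dens]; congr 1; ring
  rw [h5]
  norm_num at h1 h2 h3 h4 ⊢
  linarith

variable [BorelSpace S]

lemma two_mul_le_push {A : Set S} (hA : MeasurableSet A) {h : ℝ}
    (hd : ∀ s ∈ A, 1 / 2 ≤ P.dens 1 (-h) s) {q r : ℝ}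
    (hqr : P.cdf A h q + 4 * (r - q) < P.cdf A h r) :
    2 * volume (Icc q r) ≤ P.push 1 (-h) (Icc q r) := by
  have := P.finite
  set B := A ∩ P.proj 1 (-h) ⁻¹' Icc q r with hB
  have hBm : MeasurableSet B := hA.inter (P.measurable_proj 1 (-h) measurableSet_Icc)
  have h1 : 4 * (r - q) ≤ P.σ.real B := by
    have h2 : A ∩ {s | P.proj 1 (-h) s ≤ r} ⊆ (A ∩ {s | P.proj 1 (-h) s ≤ q}) ∪ B := by
      rintro s ⟨hs, hsr⟩
      rcases le_total (P.proj 1 (-h) s) q with h3 | h3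
      · exact Or.inl ⟨hs, h3⟩
      · exact Or.inr ⟨hs, h3, hsr⟩
    have h3 := (measureReal_mono (μ := P.σ) h2).trans (measureReal_union_le _ _)
    simp only [cdf] at hqr
    linarith
  calc 2 * volume (Icc q r) = ENNReal.ofReal (1 / 2 * (4 * (r - q))) := by
        rw [Real.volume_Icc, ← ENNReal.ofReal_ofNat, ← ENNReal.ofReal_mul zero_le_two]
        congr 1; ring
    _ ≤ ENNReal.ofReal (1 / 2 * P.σ.real B) := ENNReal.ofReal_le_ofReal (by linarith)
    _ = ∫⁻ _ in B, ENNReal.ofReal (1 / 2) ∂P.σ := by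
        rw [setLIntegral_const, ENNReal.ofReal_mul (by norm_num), ofReal_measureReal]
    _ ≤ ∫⁻ s in B, ENNReal.ofReal (P.dens 1 (-h) s) ∂P.σ :=
        setLIntegral_mono' hBm fun s hs => ENNReal.ofReal_le_ofReal (hd s hs.1)
    _ ≤ _ := by
        rw [P.push_apply _ _ measurableSet_Icc]
        exact lintegral_mono_set inter_subset_right

/-- A Vitali covering argument: the crowded places are covered by enlargements of disjoint
intervals that the projection covers at least twice. -/
lemma volume_crowded_le {A : Set S} (hA : MeasurableSet A) {h : ℝ}
    (hd : ∀ s ∈ A, 1 / 2 ≤ P.dens 1 (-h) s) :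
    volume (P.crowded A h) ≤ 4 * ENNReal.ofReal (P.waste 1 (-h)) := by
  have hcdf := P.isMovingCdf_cdf A
  choose! q hqlt hq using fun r (hr : r ∈ P.crowded A h) => hr
  set c : ℝ → ℝ := fun r => (q r + r) / 2 with hc
  set ρ : ℝ → ℝ := fun r => (r - q r) / 2 with hρ
  have hball : ∀ r, Metric.closedBall (c r) (ρ r) = Icc (q r) r := fun r => by
    rw [Real.closedBall_eq_Icc]
    congr 1 <;> simp only [hc, hρ] <;> ring
  obtain ⟨u, hut, hudisj, hucov⟩ := Vitali.exists_disjoint_subfamily_covering_enlargement_closedBall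
    (P.crowded A h) c ρ (P.σ.real A) (fun r hr => by
      have h1 := hq r hr
      have h2 := hcdf.le h r
      have h3 := hcdf.nonneg h (q r)
      have h4 := hqlt r hr
      simp only [hρ]
      linarith) 4 (by norm_num)
  simp only [hball] at hudisj
  have hucount : u.Countable := hudisj.countable_of_nonempty_interior fun r hr => by
    rw [interior_Icc]
    exact nonempty_Ioo.2 (hqlt r (hut hr))
  set E := ⋃ r ∈ u, Icc (q r) r with hE
  have hEm : MeasurableSet E := MeasurableSet.biUnion hucount fun _ _ => measurableSet_Icc
  have hEv : volume E = ∑' r : u, volume (Icc (q r) r) :=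
    measure_biUnion hucount hudisj fun _ _ => measurableSet_Icc
  have hEle : volume E ≤ ENNReal.ofReal (P.waste 1 (-h)) := by
    refine P.volume_le_waste 1 (-h) hEm ?_
    rw [hEv, ← ENNReal.tsum_mul_left, measure_biUnion hucount hudisj fun _ _ => measurableSet_Icc]
    exact ENNReal.tsum_le_tsum fun r => P.two_mul_le_push hA hd (hq r (hut r.2))
  have hcov : P.crowded A h ⊆ ⋃ r ∈ u, Metric.closedBall (c r) (4 * ρ r) := fun r hr => by
    obtain ⟨r', hr', hsub⟩ := hucov r hr
    rw [hball] at hsub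
    exact mem_biUnion hr' (hsub ⟨(hqlt r hr).le, le_rfl⟩)
  calc volume (P.crowded A h) ≤ ∑' r : u, volume (Metric.closedBall (c r) (4 * ρ r)) :=
        (measure_mono hcov).trans (measure_biUnion_le _ hucount _)
    _ = ∑' r : u, 4 * volume (Icc (q r) r) := by
        congr 1
        ext1 r
        rw [← hball, Real.volume_closedBall, Real.volume_closedBall, ← ENNReal.ofReal_ofNat 4,
          ← ENNReal.ofReal_mul (by norm_num)]
        congr 1; ring
    _ = 4 * volume E := by rw [ENNReal.tsum_mul_left, hEv]
    _ ≤ _ := by gcongr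

lemma volume_image_inter_image_le {A B : Set S} (hA : MeasurableSet A) (hB : MeasurableSet B)
    (hAB : Disjoint A B) (a b : ℝ)
    (hE : MeasurableSet (P.proj a b '' A ∩ P.proj a b '' B)) :
    volume (P.proj a b '' A ∩ P.proj a b '' B) ≤ ENNReal.ofReal (P.waste a b) := by
  set E := P.proj a b '' A ∩ P.proj a b '' B with hEdef
  have hpre : MeasurableSet (P.proj a b ⁻¹' E) := P.measurable_proj a b hE
  refine P.volume_le_waste a b hE ?_
  have key : ∀ C : Set S, MeasurableSet C → E ⊆ P.proj a b '' C → volume E ≤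
      ∫⁻ s in C ∩ P.proj a b ⁻¹' E, ENNReal.ofReal (P.dens a b s) ∂P.σ := by
    intro C hC hEC
    refine (measure_mono ?_).trans (P.volume_image_le a b _ (hC.inter hpre))
    intro r hr
    obtain ⟨s, hs, rfl⟩ := hEC hr
    exact ⟨s, ⟨hs, hr⟩, rfl⟩
  rw [two_mul, P.push_apply a b hE]
  refine (add_le_add (key A hA inter_subset_left) (key B hB inter_subset_right)).trans ?_
  rw [← lintegral_union (hB.inter hpre)
    (hAB.mono inter_subset_left inter_subset_left)]
  exact lintegral_mono_set (union_subset inter_subset_right inter_subset_right)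

lemma volume_slice_le [T2Space S] {A B : Set S} (hA : IsCompact A) (hB : IsCompact B)
    (hAB : Disjoint A B) {h : ℝ} (hdA : ∀ s ∈ A, 1 / 2 ≤ P.dens 1 (-h) s)
    (hdB : ∀ s ∈ B, 1 / 2 ≤ P.dens 1 (-h) s) :
    volume {r | fderiv ℝ (lipMinorant (P.cdf A)) (h, r) ≠ 0 ∧
      fderiv ℝ (lipMinorant (P.cdf B)) (h, r) ≠ 0} ≤ 9 * ENNReal.ofReal (P.waste 1 (-h)) := by
  have hAm := hA.measurableSet
  have hBm := hB.measurableSet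
  have hEm : MeasurableSet (P.proj 1 (-h) '' A ∩ P.proj 1 (-h) '' B) :=
    (hA.image (P.continuous_proj _ _)).measurableSet.inter
      (hB.image (P.continuous_proj _ _)).measurableSet
  have hsub : {r | fderiv ℝ (lipMinorant (P.cdf A)) (h, r) ≠ 0 ∧
      fderiv ℝ (lipMinorant (P.cdf B)) (h, r) ≠ 0} ⊆
      (P.crowded A h ∪ P.crowded B h) ∪ (P.proj 1 (-h) '' A ∩ P.proj 1 (-h) '' B) := by
    rintro r ⟨h1, h2⟩
    rcases P.mem_crowded_or_mem_image hA h1 with h3 | h3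
    · exact Or.inl (Or.inl h3)
    · rcases P.mem_crowded_or_mem_image hB h2 with h4 | h4
      · exact Or.inl (Or.inr h4)
      · exact Or.inr ⟨h3, h4⟩
  calc _ ≤ volume (P.crowded A h) + volume (P.crowded B h)
        + volume (P.proj 1 (-h) '' A ∩ P.proj 1 (-h) '' B) :=
        (measure_mono hsub).trans ((measure_union_le _ _).trans
          (add_le_add (measure_union_le _ _) le_rfl))
    _ ≤ 4 * ENNReal.ofReal (P.waste 1 (-h)) + 4 * ENNReal.ofReal (P.waste 1 (-h))
        + ENNReal.ofReal (P.waste 1 (-h)) :=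
        add_le_add (add_le_add (P.volume_crowded_le hAm hdA) (P.volume_crowded_le hBm hdB))
          (P.volume_image_inter_image_le hAm hBm hAB 1 (-h) hEm)
    _ = _ := by ring

end ParamBarrier

/-! ### Cauchy's formula -/

lemma integral_abs_cos_add (φ : ℝ) :
    ∫ t in (-(Real.pi / 2))..(Real.pi / 2), |Real.cos (t + φ)| = 2 := by
  have hper : Function.Periodic (fun t => |Real.cos t|) Real.pi := fun t => by
    simp only [Real.cos_add_pi, abs_neg]
  rw [intervalIntegral.integral_comp_add_right (fun t => |Real.cos t|)]
  have h1 := hper.intervalIntegral_add_eq (-(Real.pi / 2) + φ) (-(Real.pi / 2))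
  have h2 : -(Real.pi / 2) + φ + Real.pi = Real.pi / 2 + φ := by ring
  have h3 : -(Real.pi / 2) + Real.pi = Real.pi / 2 := by ring
  rw [h2, h3] at h1
  rw [h1]
  have h4 : ∫ t in (-(Real.pi / 2))..(Real.pi / 2), |Real.cos t| =
      ∫ t in (-(Real.pi / 2))..(Real.pi / 2), Real.cos t := by
    refine intervalIntegral.integral_congr fun t ht => ?_
    rw [uIcc_of_le (by linarith [Real.pi_pos])] at ht
    exact abs_of_nonneg (Real.cos_nonneg_of_mem_Icc ht)
  rw [h4, integral_cos, Real.sin_neg, Real.sin_pi_div_two]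
  norm_num

lemma integral_abs_cos_mul_sub_sin_mul (ξ η : ℝ) :
    ∫ t in (-(Real.pi / 2))..(Real.pi / 2), |Real.cos t * ξ + -Real.sin t * η| =
      2 * Real.sqrt (ξ ^ 2 + η ^ 2) := by
  set z : ℂ := ⟨ξ, η⟩ with hz
  have hn : ‖z‖ = Real.sqrt (ξ ^ 2 + η ^ 2) := by
    rw [Complex.norm_def, Complex.normSq_mk]; congr 1; ring
  have h1 : ‖z‖ * Real.cos z.arg = ξ := Complex.norm_mul_cos_arg z
  have h2 : ‖z‖ * Real.sin z.arg = η := Complex.norm_mul_sin_arg z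
  have h3 : ∀ t : ℝ, |Real.cos t * ξ + -Real.sin t * η| = ‖z‖ * |Real.cos (t + z.arg)| := by
    intro t
    rw [← abs_norm z, ← abs_mul, Real.cos_add]
    congr 1
    linear_combination -Real.cos t * h1 + Real.sin t * h2
  simp only [h3]
  rw [intervalIntegral.integral_const_mul, integral_abs_cos_add, hn, mul_comm]

namespace ParamBarrier

variable {S : Type*} [TopologicalSpace S] [MeasurableSpace S] (P : ParamBarrier S)

lemma waste_mul {c : ℝ} (hc : 0 ≤ c) (a b : ℝ) : P.waste (c * a) (c * b) = c * P.waste a b := by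
  have h : ∀ s, P.dens (c * a) (c * b) s = c * P.dens a b s := fun s => by
    rw [dens, dens, mul_assoc, mul_assoc, ← mul_add, abs_mul, abs_of_nonneg hc]
  simp only [waste, h, integral_const_mul, abs_mul, abs_of_nonneg hc]
  ring

/-- Cauchy's formula: the waste, integrated over all directions, is twice the excess of the length
over half the perimeter of the square. -/
lemma integral_waste_le :
    IntegrableOn (fun t => P.waste (Real.cos t) (-Real.sin t))
      (Ioc (-(Real.pi / 2)) (Real.pi / 2)) ∧
    ∫ t in (-(Real.pi / 2))..(Real.pi / 2), P.waste (Real.cos t) (-Real.sin t)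
      ≤ 2 * (P.len - 2) := by
  have := P.finite
  have hpi : -(Real.pi / 2) ≤ Real.pi / 2 := by linarith [Real.pi_pos]
  set I := Ioc (-(Real.pi / 2)) (Real.pi / 2) with hI
  set D : ℝ × S → ℝ := fun z => P.dens (Real.cos z.1) (-Real.sin z.1) z.2 with hD
  have hDm : Measurable D :=
    (((Real.measurable_cos.comp measurable_fst).mul (P.measurable_ξ.comp measurable_snd)).add
      ((Real.measurable_sin.comp measurable_fst).neg.mul
        (P.measurable_η.comp measurable_snd))).abs
  have hDi : Integrable D ((volume.restrict I).prod P.σ) := by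
    refine Integrable.of_bound hDm.aestronglyMeasurable 2 (ae_of_all _ fun z => ?_)
    rw [Real.norm_eq_abs, abs_of_nonneg (P.dens_nonneg _ _ _)]
    refine (P.dens_le _ _ _).trans ?_
    have h1 := Real.abs_cos_le_one z.1
    have h2 := Real.abs_sin_le_one z.1
    rw [abs_neg]
    linarith
  have hi1 : Integrable (fun t => ∫ s, D (t, s) ∂P.σ) (volume.restrict I) := hDi.integral_prod_left
  have hi2 : Integrable (fun t => |Real.cos t| + |-Real.sin t|) (volume.restrict I) :=
    (Continuous.integrableOn_Ioc (by fun_prop))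
  refine ⟨hi1.sub hi2, ?_⟩
  have hw : ∫ t in I, (|Real.cos t| + |-Real.sin t|) = 4 := by
    have h1 := integral_abs_cos_mul_sub_sin_mul 1 0
    have h2 := integral_abs_cos_mul_sub_sin_mul 0 1
    rw [intervalIntegral.integral_of_le hpi] at h1 h2
    norm_num at h1 h2
    simp only [abs_neg]
    rw [integral_add (Continuous.integrableOn_Ioc (by fun_prop))
      (Continuous.integrableOn_Ioc (by fun_prop)), h1, h2]
    norm_num
  have hswap : ∫ t in I, ∫ s, D (t, s) ∂P.σ ≤ 2 * P.len := by
    rw [integral_integral_swap (f := fun t s => D (t, s)) hDi]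
    have h1 : ∀ s, ∫ t in I, D (t, s) ≤ 2 := fun s => by
      have h2 := integral_abs_cos_mul_sub_sin_mul (P.ξ s) (P.η s)
      rw [intervalIntegral.integral_of_le hpi] at h2
      have h3 : Real.sqrt (P.ξ s ^ 2 + P.η s ^ 2) ≤ 1 := Real.sqrt_le_one.2 (P.speed_le s)
      simp only [hD, dens]
      linarith
    refine (integral_mono hDi.integral_prod_right (integrable_const 2) h1).trans ?_
    simp [len, mul_comm]
  rw [intervalIntegral.integral_of_le hpi]
  simp only [waste]
  rw [integral_sub hi1 hi2, hw]
  linarith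

variable [BorelSpace S]

lemma lintegral_waste_le :
    ∫⁻ h in Icc (-24) 24, ENNReal.ofReal (P.waste 1 (-h)) ≤
      ENNReal.ofReal (14425 * (2 * (P.len - 2))) := by
  set g : ℝ → ℝ≥0∞ := fun t => ENNReal.ofReal (P.waste (Real.cos t) (-Real.sin t)) with hg
  have hpt : ∀ h ∈ Icc (-24 : ℝ) 24, ENNReal.ofReal (P.waste 1 (-h)) ≤
      ENNReal.ofReal 14425 * (ENNReal.ofReal |1 / (1 + h ^ 2)| * g (Real.arctan h)) := by
    intro h hh
    have hs : 0 < Real.sqrt (1 + h ^ 2) := Real.sqrt_pos.2 (by positivity)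
    have hh2 : h ^ 2 ≤ 24 ^ 2 := sq_le_sq' hh.1 hh.2
    have hs25 : Real.sqrt (1 + h ^ 2) ≤ 25 := by
      rw [Real.sqrt_le_left (by norm_num)]
      linarith
    have h1 : P.waste (Real.cos (Real.arctan h)) (-Real.sin (Real.arctan h)) =
        1 / Real.sqrt (1 + h ^ 2) * P.waste 1 (-h) := by
      rw [← P.waste_mul (by positivity), Real.cos_arctan, Real.sin_arctan]
      congr 1 <;> ring
    have hw := P.waste_nonneg 1 (-h)
    rw [hg]
    simp only [h1]
    rw [← ENNReal.ofReal_mul (abs_nonneg _), ← ENNReal.ofReal_mul (by norm_num)]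
    refine ENNReal.ofReal_le_ofReal ?_
    -- The factor `(1 + h²)^(3/2)` comes from `dh = (1 + h²) dt` and from normalizing `(1, -h)`.
    have h2 : (1 + h ^ 2) * Real.sqrt (1 + h ^ 2) ≤ 14425 := by
      calc (1 + h ^ 2) * Real.sqrt (1 + h ^ 2) ≤ 577 * 25 :=
            mul_le_mul (by linarith) hs25 hs.le (by norm_num)
        _ = 14425 := by norm_num
    rw [abs_of_pos (by positivity), ← mul_assoc, ← mul_assoc]
    refine le_mul_of_one_le_left hw ?_
    rw [mul_assoc, div_mul_div_comm, one_mul, mul_one_div, le_div_iff₀ (by positivity), one_mul]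
    exact h2
  have himage : Real.arctan '' Icc (-24) 24 ⊆ Ioc (-(Real.pi / 2)) (Real.pi / 2) := by
    rintro _ ⟨h, -, rfl⟩
    exact ⟨Real.neg_pi_div_two_lt_arctan h, (Real.arctan_lt_pi_div_two h).le⟩
  obtain ⟨hint, hle⟩ := P.integral_waste_le
  calc ∫⁻ h in Icc (-24) 24, ENNReal.ofReal (P.waste 1 (-h))
      ≤ ∫⁻ h in Icc (-24) 24,
          ENNReal.ofReal 14425 * (ENNReal.ofReal |1 / (1 + h ^ 2)| * g (Real.arctan h)) :=
        setLIntegral_mono' measurableSet_Icc hpt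
    _ = ENNReal.ofReal 14425 * ∫⁻ t in Real.arctan '' Icc (-24) 24, g t := by
        rw [lintegral_const_mul' _ _ ENNReal.ofReal_ne_top,
          lintegral_image_eq_lintegral_abs_deriv_mul measurableSet_Icc
            (fun h _ => (Real.hasDerivAt_arctan h).hasDerivWithinAt)
            Real.arctan_injective.injOn]
    _ ≤ ENNReal.ofReal 14425 * ∫⁻ t in Ioc (-(Real.pi / 2)) (Real.pi / 2), g t := by
        gcongr
    _ = ENNReal.ofReal 14425 * ENNReal.ofReal
        (∫ t in (-(Real.pi / 2))..(Real.pi / 2), P.waste (Real.cos t) (-Real.sin t)) := by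
        rw [intervalIntegral.integral_of_le (by linarith [Real.pi_pos]),
          ofReal_integral_eq_lintegral_ofReal hint (ae_of_all _ fun t => P.waste_nonneg _ _)]
    _ ≤ _ := by
        rw [← ENNReal.ofReal_mul (by norm_num)]
        exact ENNReal.ofReal_le_ofReal (by linarith)

/-! ### Shared lines -/

/-- Nearly horizontal pieces above the middle and nearly horizontal pieces below it share many
lines, and each shared line is wasted. -/
lemma real_mul_real_le [T2Space S] (hL : P.len < 2 + 1 / 10 ^ 12) {A B : Set S}
    (hA : IsCompact A) (hB : IsCompact B) (hAh : A ⊆ P.horiz ∩ {s | 1 / 16 < 1 * P.y s})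
    (hBh : B ⊆ P.horiz ∩ {s | 1 / 16 < -1 * P.y s}) :
    P.σ.real A * P.σ.real B ≤ 1 / 10 ^ 4 := by
  have := P.finite
  have hdisj : Disjoint A B := disjoint_left.2 fun s hsA hsB => by
    have h1 : 1 / 16 < 1 * P.y s := (hAh hsA).2
    have h2 : 1 / 16 < -1 * P.y s := (hBh hsB).2
    linarith
  have hle2 : ∀ C : Set S, P.σ.real (P.horiz ∩ C) ≤ 4 * (1 / 2) := fun C => by
    have h1 := P.real_horiz_le hL
    have h2 : P.σ.real (P.horiz ∩ C) ≤ P.σ.real P.horiz := measureReal_mono inter_subset_left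
    norm_num at h1 ⊢
    linarith
  have hempty : ∀ (C : Set S) (h r : ℝ), (∀ s ∈ C, r < P.proj 1 (-h) s) → P.cdf C h r = 0 :=
    fun C h r hC => by
      rw [cdf, show C ∩ {s | P.proj 1 (-h) s ≤ r} = ∅ from
        eq_empty_of_forall_notMem fun s hs => (hC s hs.1).not_ge hs.2, measureReal_empty]
  have hfull : ∀ (C : Set S) (h r : ℝ), (∀ s ∈ C, P.proj 1 (-h) s ≤ r) →
      P.cdf C h r = P.σ.real C := fun C h r hC => by
    rw [cdf, show C ∩ {s | P.proj 1 (-h) s ≤ r} = C from inter_eq_left.2 hC]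
  have hx : ∀ s, -1 ≤ P.x s ∧ P.x s ≤ 1 := fun s => abs_le.1 (P.abs_x_le s)
  have hyA : ∀ s ∈ A, 1 / 16 < P.y s := fun s hs => by
    have h : 1 / 16 < 1 * P.y s := (hAh hs).2
    linarith
  have hyB : ∀ s ∈ B, P.y s < -(1 / 16) := fun s hs => by
    have h : 1 / 16 < -1 * P.y s := (hBh hs).2
    linarith
  -- At the times `±24`, the heights beyond `1/16` outweigh `|x| ≤ 1` by `24 / 16 - 1 = 1 / 2`.
  have hsub := (P.isMovingCdf_cdf A).Ioo_prod_Ioo_subset_image (P.isMovingCdf_cdf B)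
    (K := 24) (δ := 1 / 2) (by norm_num) (by norm_num)
    ((measureReal_mono hAh).trans (hle2 _)) ((measureReal_mono hBh).trans (hle2 _))
    (fun r hr => hempty _ _ _ fun s hs => by
      have h1 := hyA s hs; have h2 := hx s; simp only [proj]; linarith)
    (fun r hr => hfull _ _ _ fun s hs => by
      have h1 := hyA s hs; have h2 := hx s; simp only [proj]; linarith)
    (fun r hr => hempty _ _ _ fun s hs => by
      have h1 := hyB s hs; have h2 := hx s; simp only [proj]; linarith)
    (fun r hr => hfull _ _ _ fun s hs => by
      have h1 := hyB s hs; have h2 := hx s; simp only [proj]; linarith)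
  set f := lipMinorant (P.cdf A) with hf
  set g := lipMinorant (P.cdf B) with hg
  set E : Set (ℝ × ℝ) := {z | fderiv ℝ f z ≠ 0 ∧ fderiv ℝ g z ≠ 0} with hE
  have hEm : MeasurableSet E :=
    (measurable_fderiv ℝ f (measurableSet_singleton 0)).compl.inter
      (measurable_fderiv ℝ g (measurableSet_singleton 0)).compl
  have hvol : volume ((Icc (-24 : ℝ) 24 ×ˢ univ) ∩ E) ≤
      9 * ENNReal.ofReal (14425 * (2 * (P.len - 2))) := by
    rw [Measure.volume_eq_prod, Measure.prod_apply
      ((measurableSet_Icc.prod MeasurableSet.univ).inter hEm)]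
    calc ∫⁻ h, volume (Prod.mk h ⁻¹' ((Icc (-24 : ℝ) 24 ×ˢ univ) ∩ E))
        ≤ ∫⁻ h, (Icc (-24 : ℝ) 24).indicator
            (fun h => 9 * ENNReal.ofReal (P.waste 1 (-h))) h := by
          refine lintegral_mono fun h => ?_
          by_cases hh : h ∈ Icc (-24 : ℝ) 24
          · rw [indicator_of_mem hh]
            refine (measure_mono fun r hr => ?_).trans (P.volume_slice_le hA hB hdisj
              (fun s hs => P.half_le_dens (hAh hs).1 hh)
              (fun s hs => P.half_le_dens (hBh hs).1 hh))
            exact hr.2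
          · have hemp : Prod.mk h ⁻¹' ((Icc (-24 : ℝ) 24 ×ˢ univ) ∩ E) = ∅ :=
              eq_empty_of_forall_notMem fun r hr => hh hr.1.1
            rw [hemp, measure_empty]
            exact zero_le
      _ = 9 * ∫⁻ h in Icc (-24 : ℝ) 24, ENNReal.ofReal (P.waste 1 (-h)) := by
          rw [lintegral_indicator measurableSet_Icc, lintegral_const_mul' _ _ (by norm_num)]
      _ ≤ _ := by gcongr; exact P.lintegral_waste_le
  have hmain : ENNReal.ofReal (P.σ.real A * P.σ.real B) ≤
      ENNReal.ofReal (64 * (9 * (14425 * (2 * (P.len - 2))))) := by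
    calc ENNReal.ofReal (P.σ.real A * P.σ.real B)
        = volume (Ioo 0 (P.σ.real A) ×ˢ Ioo 0 (P.σ.real B)) := by
          rw [Measure.volume_eq_prod, Measure.prod_prod, Real.volume_Ioo, Real.volume_Ioo,
            sub_zero, sub_zero, ENNReal.ofReal_mul measureReal_nonneg]
      _ ≤ volume ((fun z => (f z, g z)) '' (Icc (-24 : ℝ) 24 ×ˢ univ)) := measure_mono hsub
      _ ≤ 64 * volume ((Icc (-24 : ℝ) 24 ×ˢ univ) ∩ E) :=
          volume_image_le_of_lipschitz (P.isMovingCdf_cdf A).lipschitzWith_lipMinorant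
            (P.isMovingCdf_cdf B).lipschitzWith_lipMinorant _
      _ ≤ 64 * (9 * ENNReal.ofReal (14425 * (2 * (P.len - 2)))) := by gcongr
      _ = _ := by
          rw [ENNReal.ofReal_mul (p := 64) (by norm_num), ENNReal.ofReal_mul (p := 9) (by norm_num),
            ENNReal.ofReal_ofNat, ENNReal.ofReal_ofNat]
  have h2 := P.two_le_len
  rw [ENNReal.ofReal_le_ofReal_iff (by linarith)] at hmain
  norm_num at hmain hL ⊢
  linarith

/-- A barrier whose nearly horizontal part has a large second vertical moment is not short. -/
lemma not_le_integral_y_sq [T2Space S] (hreg : P.σ.InnerRegularCompactLTTop)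
    (hL : P.len < 2 + 1 / 10 ^ 12) :
    ¬ 1 / 4 - 6 / 10 ^ 3 ≤ ∫ s, P.y s ^ 2 * P.horiz.indicator 1 s ∂P.σ := by
  intro h
  have := P.finite
  have key : ∀ e : ℝ, |e| = 1 → ∃ A ⊆ P.horiz ∩ {s | 1 / 16 < e * P.y s}, IsCompact A ∧
      1 / 20 < P.σ.real A := by
    intro e he
    have h1 := P.lt_real_horiz_inter hL h he
    have hm : MeasurableSet (P.horiz ∩ {s | 1 / 16 < e * P.y s}) :=
      P.measurableSet_horiz.inter
        (measurableSet_lt measurable_const (P.measurable_y.const_mul e))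
    obtain ⟨A, hA, hAc, hlt⟩ := hm.exists_lt_isCompact_of_ne_top (measure_ne_top P.σ _)
      (r := ENNReal.ofReal (1 / 20)) (by
        rw [← ofReal_measureReal]
        exact (ENNReal.ofReal_lt_ofReal_iff (by linarith)).2 h1)
    refine ⟨A, hA, hAc, ?_⟩
    rw [← ofReal_measureReal] at hlt
    exact (ENNReal.ofReal_lt_ofReal_iff_of_nonneg (by norm_num)).1 hlt
  obtain ⟨A, hA, hAc, hAlt⟩ := key 1 (by simp)
  obtain ⟨B, hB, hBc, hBlt⟩ := key (-1) (by simp)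
  have := P.real_mul_real_le hL hAc hBc hA hB
  norm_num at this hAlt hBlt
  nlinarith

theorem le_len [T2Space S] (hreg : P.σ.InnerRegularCompactLTTop) :
    2 + 1 / 10 ^ 12 ≤ P.len := by
  by_contra! hL
  -- The reflection in the diagonal turns the second alternative into the first.
  rcases P.le_integral_y_sq_or hL with h | h
  · exact P.not_le_integral_y_sq hreg hL h
  · exact P.swap.not_le_integral_y_sq hreg hL h

end ParamBarrier

end OpaqueSquare

theorem theorem1 {ι : Type*} (γ : ι → OpaqueSquare.Curve)
    (hγ : OpaqueSquare.IsRectifiableBarrier γ OpaqueSquare.unitSquare)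
    (hloc : OpaqueSquare.trace γ ⊆ OpaqueSquare.doubleSquare) :
    ENNReal.ofReal (2 + 1 / 10 ^ 12) ≤ OpaqueSquare.totalLength γ := by
  have := hγ.countable
  let : TopologicalSpace ι := ⊥
  have : DiscreteTopology ι := ⟨rfl⟩
  let : MeasurableSpace ι := ⊤
  obtain ⟨P, hP⟩ := hγ.exists_paramBarrier hloc
  have := P.finite
  rw [← hP, ← ofReal_measureReal]
  exact ENNReal.ofReal_le_ofReal (P.le_len inferInstance)
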